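/- **Setting.** Let $\mathcal H$ be a finite set, $\Xi\subseteq\mathbb R^m$ closed, and let $(\eta_t)_{t\ge1}$ be a time-homogeneous Markov chain on $\mathcal H$ with transition matrix $\varpi$ and deterministic initial state $\eta_1$. For $h\in\mathcal H$ let $q(\cdot\mid h)$ be a probability density on $\Xi$. Let $\mathbb P^*$ be the law of the process $(\xi_t,\eta_t)_{t\ge1}$ in which, given the whole context sequence $(\eta_t)_{t\ge1}$, the $\xi_t\in\Xi$ are independent with densities $q(\cdot\mid\eta_t)$. Let $\nu$ be a stationary distribution of $\varpi$ and put $\mathrm dP^*(\xi,h)=\nu(h)\,q(\xi\mid h)\,\mathrm d\xi$. Let $\Theta\subset\mathbb R^d$, let $p$ be a prior probability density on $\Theta$, and let $\{f(\cdot\mid h,\theta):\theta\in\Theta\}$, $h\in\mathcal H$, be probability densities on $\Xi$. Define $$\psi(\theta)=\mathbb E_{P^*}[\log f(\xi\mid\eta,\theta)],\qquad \Theta^*=\operatorname*{arg\,max}_{\theta\in\Theta}\psi(\theta),$$ and, for $N\ge1$, the posterior density and posterior measure $$\mathsf p_N(\theta)=\frac{\mathsf f_N(\theta)p(\theta)}{\int_\Theta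 \mathsf f_N(\theta')p(\theta')\,\mathrm d\theta'},\quad \mathsf f_N(\theta)=f(\xi_1\mid\eta_1,\theta)\prod_{i=2}^N f(\xi_i\mid\eta_i,\theta)\,\varpi_{\eta_{i-1},\eta_i},\quad \mathsf P_N(A)=\int_{A\cap\Theta}\mathsf p_N(\theta)\,\mathrm d\theta .$$ **Assumptions.** (i) $\Theta$ is compact with nonempty interior. (ii) There are constants $c_1\ge c_2>0$ with $c_1\ge p(\theta)\ge c_2$ for all $\theta\in\Theta$. (iii) $f(\xi\mid h,\theta)>0$ for all $\xi\in\Xi$, $h\in\mathcal H$, $\theta\in\Theta$. (iv) For all $\xi\in\Xi$, $h\in\mathcal H$, the map $\theta\mapsto f(\xi\mid h,\theta)$ is continuous on $\Theta$. (v) The chain $(\eta_t)$ is irreducible and aperiodic. (vi) There is a $P^*$-integrable $G$ such that for $P^*$-almost every $(\xi,h)$, $|\log f(\xi\mid h,\theta)|\le G(\xi,h)$ for all $\theta\in\Theta$. (vii) For every $r>0$, the set $\{\theta\in\Theta:\|\theta-\theta^*\|_2<r\text{ for some }\theta^*\in\Theta^*\}$ has positive Lebesgue measure. (Given (i)–(vi),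 this is automatic if, for example, $\Theta$ is the closure of its interior, or if $\Theta^*$ meets the interior of $\Theta$.) **Theorem (posterior consistency).** $\mathbb P^*$-almost surely, $\mathsf P_N$ is a probability measure for every $N\ge1$, and if $\theta_N\sim\mathsf P_N$ then $\operatorname{dist}(\theta_N,\Theta^*)\to0$ in $\mathsf P_N$-probability, i.e. $$\mathsf P_N\big(\{\theta:\operatorname{dist}(\theta,\Theta^*)\ge\varepsilon\}\big)\to0\quad\text{as }N\to\infty,\text{ for every }\varepsilon>0,$$ where $\operatorname{dist}$ is the Euclidean distance. In particular, if $\Theta^*=\{\theta^*\}$, then $\mathbb P^*$-almost surely $\theta_N\to\theta^*$ in $\mathsf P_N$-probability. Moreover, if $\log q(\cdot\mid h)$ is integrable with respect to $q(\xi\mid h)\,\mathrm d\xi$ for every $h\in\mathcal H$, then $$\Theta^*=\operatorname*{arg\,min}_{\theta\in\Theta}\sum_{h\in\mathcal H}\nu(h)\,D_{\mathrm{KL}}\big(q(\cdot\mid h)\,\big\|\,f(\cdot\mid h,\theta)\big).$$ -/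

import Mathlib

open MeasureTheory ProbabilityTheory Filter Topology Set

noncomputable section

namespace ContextualBayes

/-- `g` is a probability density with respect to the reference measure `volume`. -/
structure IsDensity {X : Type*} [MeasureSpace X] (g : X → ℝ) : Prop where
  measurable : Measurable g
  nonneg : ∀ x, 0 ≤ g x
  integral_eq_one : ∫ x, g x = 1

/-- The measure `g(x) dx`. -/
def densityMeasure {X : Type*} [MeasureSpace X] (g : X → ℝ) : Measure X :=
  (volume : Measure X).withDensity fun x => ENNReal.ofReal (g x)

/-- Every state `i` has period one: the only common divisor of the possible return times
`{n ≥ 1 : (ϖ ^ n) i i > 0}` is `1`. -/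
def IsAperiodic {H : Type*} [Fintype H] [DecidableEq H] (ϖ : Matrix H H ℝ) : Prop :=
  ∀ i : H, ∀ k : ℕ, (∀ n : ℕ, 1 ≤ n → 0 < (ϖ ^ n) i i → k ∣ n) → k = 1

/-- `ν` is a stationary distribution of the chain with transition matrix `ϖ`. -/
def IsStationary {H : Type*} [Fintype H] (ϖ : Matrix H H ℝ) (ν : H → ℝ) : Prop :=
  ν ∈ stdSimplex ℝ H ∧ Matrix.vecMul ν ϖ = ν

/-- `(ξ t, η t)`, `t = 0, 1, …` (so that time `t` here is time `t + 1` in one-based notation) has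
the true law: `η` is the Markov chain with transition matrix `ϖ` started at the deterministic
state `h₁`, and given the whole context sequence the `ξ t` are independent with densities
`q (η t)`. This is expressed through the finite-dimensional distributions. -/
structure IsDataProcess {Ω X H : Type*} [MeasurableSpace Ω] [MeasureSpace X] [MeasurableSpace H]
    [DecidableEq H]
    (P : Measure Ω) (ϖ : Matrix H H ℝ) (q : H → X → ℝ) (h₁ : H)
    (ξ : ℕ → Ω → X) (η : ℕ → Ω → H) : Prop where
  measurable_ξ : ∀ t, Measurable (ξ t)
  measurable_η : ∀ t, Measurable (η t)
  law : ∀ (n : ℕ) (a : ℕ → H) (A : ℕ → Set X), (∀ t, MeasurableSet (A t)) →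
    P {ω | ∀ t ≤ n, η t ω = a t ∧ ξ t ω ∈ A t} =
      (if a 0 = h₁ then 1 else 0)
        * (∏ t ∈ Finset.range n, ENNReal.ofReal (ϖ (a t) (a (t + 1))))
        * ∏ t ∈ Finset.range (n + 1), densityMeasure (q (a t)) (A t)

/-- The stationary law `dP*(ξ, h) = ν(h) q(ξ | h) dξ` on pairs (randomness, context). -/
def stationaryLaw {X H : Type*} [MeasureSpace X] [MeasurableSpace H] [Fintype H]
    (ν : H → ℝ) (q : H → X → ℝ) : Measure (X × H) :=
  ∑ h, ENNReal.ofReal (ν h) • (densityMeasure (q h)).map fun x => (x, h)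

/-- The population log-likelihood `ψ(θ) = E_{P*}[log f(ξ | η, θ)]`. -/
def psi {X H T : Type*} [MeasureSpace X] [MeasurableSpace H] [Fintype H]
    (ν : H → ℝ) (q : H → X → ℝ) (f : X → H → T → ℝ) (θ : T) : ℝ :=
  ∫ z, Real.log (f z.1 z.2 θ) ∂(stationaryLaw ν q)

/-- `Θ* = argmax_{θ ∈ Θ} ψ(θ)`. -/
def thetaStar {X H T : Type*} [MeasureSpace X] [MeasurableSpace H] [Fintype H]
    (ν : H → ℝ) (q : H → X → ℝ) (f : X → H → T → ℝ) (Θ : Set T) : Set T :=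
  {θ ∈ Θ | ∀ θ' ∈ Θ, psi ν q f θ' ≤ psi ν q f θ}

/-- The Kullback-Leibler divergence from `q(· | h)` to `f(· | h, θ)`, averaged over `h ∼ ν`. -/
def averagedKL {X H T : Type*} [MeasureSpace X] [Fintype H]
    (ν : H → ℝ) (q : H → X → ℝ) (f : X → H → T → ℝ) (θ : T) : ENNReal :=
  ∑ h, ENNReal.ofReal (ν h) *
    InformationTheory.klDiv (densityMeasure (q h)) (densityMeasure fun x => f x h θ)

/-- The likelihood of the first `N ≥ 1` observations,
`f(ξ₀ | η₀, θ) ∏_{i = 1}^{N - 1} f(ξᵢ | ηᵢ, θ) ϖ(ηᵢ₋₁, ηᵢ)` in zero-based indexing. -/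
def likelihood {X H T : Type*} (ϖ : Matrix H H ℝ) (f : X → H → T → ℝ)
    (x : ℕ → X) (y : ℕ → H) (N : ℕ) (θ : T) : ℝ :=
  f (x 0) (y 0) θ *
    ∏ i ∈ Finset.range (N - 1), (f (x (i + 1)) (y (i + 1)) θ * ϖ (y i) (y (i + 1)))

/-- The posterior density on `Θ` given the first `N ≥ 1` observations. -/
def posteriorDensity {X H T : Type*} [MeasureSpace T] (ϖ : Matrix H H ℝ) (f : X → H → T → ℝ)
    (p : T → ℝ) (Θ : Set T) (x : ℕ → X) (y : ℕ → H) (N : ℕ) (θ : T) : ℝ :=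
  likelihood ϖ f x y N θ * p θ / ∫ θ' in Θ, likelihood ϖ f x y N θ' * p θ'

/-- The posterior measure `A ↦ ∫_{A ∩ Θ} p_N(θ) dθ`. -/
def posterior {X H T : Type*} [MeasureSpace T] (ϖ : Matrix H H ℝ) (f : X → H → T → ℝ)
    (p : T → ℝ) (Θ : Set T) (x : ℕ → X) (y : ℕ → H) (N : ℕ) : Measure T :=
  ((volume : Measure T).restrict Θ).withDensity fun θ =>
    ENNReal.ofReal (posteriorDensity ϖ f p Θ x y N θ)

/-- If `θ_N` has law `μ N`, then `g(θ_N) → c` in probability (under `μ N`). -/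
def TendstoInProb {T Y : Type*} [MeasurableSpace T] [PseudoMetricSpace Y]
    (μ : ℕ → Measure T) (g : T → Y) (c : Y) : Prop :=
  ∀ ε : ℝ, 0 < ε → Tendsto (fun N => μ N {θ | ε ≤ dist (g θ) c}) atTop (𝓝 0)

end ContextualBayes

end

-- Lebesgue measure on the sample space `Ξ ⊆ ℝᵐ`, regarded as a type.
attribute [local instance] MeasureTheory.Measure.Subtype.measureSpace

/-! Up to a factor free of `θ`, the likelihood is `exp (N * ℓ_N θ)`, where `ℓ_N` is the averaged
log-likelihood. If `ℓ_N → ψ` uniformly on `Θ`, the likelihood away from `Θ*` is exponentially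
smaller than on a set of positive measure near `Θ*`, and a prior bounded above and below cannot
offset this (`posterior_le`, `tendsto_posterior_compl_thickening`).

The uniform convergence is a strong law for random elements of the separable Banach space `C(Θ, ℝ)`,
whose sup norms are dominated by `G` (`exists_tendsto_average_logLikelihood`). Given the contexts,
the observations made at one state are i.i.d.; the classical strong law applies along the visits to
each state, and the pieces are reassembled with the visit frequencies (`ae_tendsto_average`).

These frequencies converge to `ν` (`IsMarkovChain.ae_tendsto_count_div`): by the Poisson equation, a
centred visit count is a bounded term plus a martingale with orthogonal increments. Second moments
control the times `k ^ 2`, and monotonicity of the count fills the gaps.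

For the last claim, the averaged divergence is a constant minus `ψ`
(`thetaStar_eq_argmin_averagedKL`). -/

namespace ContextualBayes

/-! ### Irreducible stochastic matrices and the Poisson equation. -/

section LinearAlgebra

variable {H : Type*} [Fintype H] [DecidableEq H] {ϖ : Matrix H H ℝ}

lemma pow_mulVec_of_mulVec_eq {v : H → ℝ} (hv : ϖ.mulVec v = v) (k : ℕ) :
    (ϖ ^ k).mulVec v = v := by
  induction k with
  | zero => simp
  | succ k ih => rw [pow_succ, ← Matrix.mulVec_mulVec, hv, ih]

lemma vecMul_pow_of_vecMul_eq {v : H → ℝ} (hv : Matrix.vecMul v ϖ = v) (k : ℕ) :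
    Matrix.vecMul v (ϖ ^ k) = v := by
  induction k with
  | zero => simp
  | succ k ih => rw [pow_succ, ← Matrix.vecMul_vecMul, ih, hv]

/-- Harmonic functions of an irreducible stochastic matrix are constant. -/
lemma eq_of_mulVec_eq_self (hϖ : ϖ ∈ Matrix.rowStochastic ℝ H) (hirr : ϖ.IsIrreducible)
    {v : H → ℝ} (hv : ϖ.mulVec v = v) (i j : H) : v i = v j := by
  obtain ⟨m, -, hm⟩ := Finset.exists_max_image Finset.univ v ⟨i, Finset.mem_univ i⟩
  have key : ∀ j, v m = v j := by
    intro j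
    obtain ⟨k, -, hk⟩ := (Matrix.isIrreducible_iff_exists_pow_pos hirr.nonneg).1 hirr m j
    have hs : ϖ ^ k ∈ Matrix.rowStochastic ℝ H := pow_mem hϖ k
    -- Maximum principle: `v m` is an average of values that do not exceed it, so every value with
    -- positive weight equals it.
    have h0 : ∑ l, (ϖ ^ k) m l * (v m - v l) = 0 := by
      have h1 := congrFun (pow_mulVec_of_mulVec_eq hv k) m
      simp only [Matrix.mulVec, dotProduct] at h1
      simp only [mul_sub, Finset.sum_sub_distrib, ← Finset.sum_mul, h1,
        Matrix.sum_row_of_mem_rowStochastic hs]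
      ring
    have h2 := (Finset.sum_eq_zero_iff_of_nonneg (fun l _ => mul_nonneg
      (Matrix.nonneg_of_mem_rowStochastic hs) (sub_nonneg.2 (hm l (Finset.mem_univ l))))).1 h0
      j (Finset.mem_univ j)
    rcases mul_eq_zero.1 h2 with h | h
    · exact absurd h hk.ne'
    · linarith
  rw [← key i, ← key j]

/-- A stationary distribution of an irreducible chain charges every state. -/
lemma IsStationary.pos {ν : H → ℝ} (hν : IsStationary ϖ ν) (hirr : ϖ.IsIrreducible) (j : H) :
    0 < ν j := by
  obtain ⟨i, -, hi⟩ : ∃ i ∈ Finset.univ, 0 < ν i := by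
    by_contra! h
    have h1 : ∑ i, ν i ≤ 0 := Finset.sum_nonpos h
    linarith [hν.1.2]
  obtain ⟨k, -, hk⟩ := (Matrix.isIrreducible_iff_exists_pow_pos hirr.nonneg).1 hirr i j
  rw [← vecMul_pow_of_vecMul_eq hν.2 k]
  simp only [Matrix.vecMul, dotProduct]
  exact Finset.sum_pos' (fun l _ => mul_nonneg (hν.1.1 l)
    (Matrix.pow_apply_nonneg hirr.nonneg k l j)) ⟨i, Finset.mem_univ i, mul_pos hi hk⟩

/-- Solvability of the Poisson equation for an irreducible chain. -/
lemma exists_sub_mulVec_eq (hϖ : ϖ ∈ Matrix.rowStochastic ℝ H) (hirr : ϖ.IsIrreducible)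
    {ν : H → ℝ} (hν : IsStationary ϖ ν) {g : H → ℝ} (hg : ν ⬝ᵥ g = 0) :
    ∃ u : H → ℝ, u - ϖ.mulVec u = g := by
  -- Dimension count: stationarity puts the range of `T` inside `ker φ`, which has codimension one.
  -- The kernel of `T` contains only constants, so the range has codimension at most one and the two
  -- subspaces agree.
  let T : (H → ℝ) →ₗ[ℝ] (H → ℝ) := LinearMap.id - ϖ.mulVecLin
  let φ : (H → ℝ) →ₗ[ℝ] ℝ := dotProductBilin ℝ ℝ ν
  have hle : LinearMap.range T ≤ LinearMap.ker φ := by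
    rintro _ ⟨u, rfl⟩
    simp [T, φ, Matrix.dotProduct_mulVec, hν.2]
  have hφ1 : φ 1 = 1 := by
    simpa [φ, dotProduct] using hν.1.2
  have hφ : Module.finrank ℝ (LinearMap.range φ) = 1 := by
    rw [LinearMap.range_eq_top.2 (fun c => ⟨c • 1, by simp [hφ1]⟩)]
    simp
  have hker : Module.finrank ℝ (LinearMap.ker T) ≤ 1 := by
    refine (Submodule.finrank_mono (t := Submodule.span ℝ {(1 : H → ℝ)}) ?_).trans
      ((finrank_span_le_card _).trans (by simp))
    intro v hv
    have hv' : ϖ.mulVec v = v := by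
      have : v - ϖ.mulVec v = 0 := hv
      exact (sub_eq_zero.1 this).symm
    rcases isEmpty_or_nonempty H with hH | ⟨⟨i⟩⟩
    · rw [Subsingleton.elim v 0]; exact zero_mem _
    · refine Submodule.mem_span_singleton.2 ⟨v i, funext fun j => ?_⟩
      simpa using eq_of_mulVec_eq_self hϖ hirr hv' i j
  have h1 := LinearMap.finrank_range_add_finrank_ker T
  have h2 := LinearMap.finrank_range_add_finrank_ker φ
  have heq := Submodule.eq_of_le_of_finrank_le hle (by omega)
  have : g ∈ LinearMap.range T := by rw [heq]; exact hg
  exact this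

end LinearAlgebra

/-! ### Convergence along a subsequence and interpolation. -/

/-- By Tonelli the series of the `f n` has finite integral, so it is finite almost everywhere and
its terms vanish in the limit. -/
lemma ae_tendsto_zero_of_summable_integral {Ω : Type*} [MeasurableSpace Ω] {P : Measure Ω}
    {f : ℕ → Ω → ℝ} (h0 : ∀ n ω, 0 ≤ f n ω) (hint : ∀ n, Integrable (f n) P)
    (hsum : Summable fun n => ∫ ω, f n ω ∂P) :
    ∀ᵐ ω ∂P, Tendsto (fun n => f n ω) atTop (𝓝 0) := by
  have h1 : ∫⁻ ω, ∑' n, ENNReal.ofReal (f n ω) ∂P ≠ ⊤ := by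
    rw [lintegral_tsum fun n => (hint n).aemeasurable.ennreal_ofReal]
    simp_rw [← ofReal_integral_eq_lintegral_ofReal (hint _) (ae_of_all _ (h0 _))]
    exact hsum.tsum_ofReal_ne_top
  filter_upwards [ae_lt_top' (AEMeasurable.tsum fun n =>
    (hint n).aemeasurable.ennreal_ofReal) h1] with ω hω
  have h2 := (ENNReal.tendsto_toReal ENNReal.zero_ne_top).comp
    (ENNReal.tendsto_atTop_zero_of_tsum_ne_top hω.ne)
  simpa [Function.comp_def, ENNReal.toReal_ofReal (h0 _ _)] using h2

/-- Consecutive squares have ratio tending to `1`, so monotonicity controls `u n / n` between them.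
-/
lemma tendsto_div_of_monotone_of_tendsto_div_sq {u : ℕ → ℝ} {l : ℝ} (hu : Monotone u)
    (h : Tendsto (fun k : ℕ => u (k ^ 2) / (k ^ 2 : ℕ)) atTop (𝓝 l)) :
    Tendsto (fun n => u n / n) atTop (𝓝 l) := by
  refine tendsto_div_of_monotone_of_exists_subseq_tendsto_div u l hu fun a ha =>
    ⟨fun k => k ^ 2, ?_, tendsto_pow_atTop two_ne_zero, h⟩
  have h1 : Tendsto (fun k : ℕ => (1 + 1 / (k : ℝ)) ^ 2) atTop (𝓝 ((1 + 0) ^ 2)) :=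
    (tendsto_const_nhds.add tendsto_one_div_atTop_nhds_zero_nat).pow 2
  filter_upwards [h1.eventually (gt_mem_nhds (by simpa using ha)), eventually_gt_atTop 0]
    with k hk hk0
  have hk0 : (0 : ℝ) < k := by exact_mod_cast hk0
  have h2 : ((k + 1 : ℕ) : ℝ) = k * (1 + 1 / k) := by
    push_cast
    field_simp
  push_cast at h2 ⊢
  rw [h2, mul_pow, mul_comm]
  gcongr

/-! ### The ergodic theorem for finite Markov chains. -/

section MarkovChain

set_option linter.unusedSectionVars false

/-- `η` is a Markov chain with transition matrix `ϖ` started at `h₁`. -/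
structure IsMarkovChain {Ω H : Type*} [MeasurableSpace Ω] [MeasurableSpace H] [DecidableEq H]
    (P : Measure Ω) (ϖ : Matrix H H ℝ) (h₁ : H) (η : ℕ → Ω → H) : Prop where
  measurable : ∀ t, Measurable (η t)
  law : ∀ (n : ℕ) (a : ℕ → H), P {ω | ∀ t ≤ n, η t ω = a t} =
    (if a 0 = h₁ then 1 else 0) * ∏ t ∈ Finset.range n, ENNReal.ofReal (ϖ (a t) (a (t + 1)))

variable {Ω H : Type*} [Fintype H] [DecidableEq H] [MeasurableSpace H]
  [MeasurableSingletonClass H] [MeasurableSpace Ω] {P : Measure Ω} [IsProbabilityMeasure P]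
  {ϖ : Matrix H H ℝ} {h₁ : H} {η : ℕ → Ω → H}

/-- The first `n + 1` states of a trajectory. -/
def initialPath (η : ℕ → Ω → H) (n : ℕ) (ω : Ω) : Fin (n + 1) → H := fun i => η i ω

/-- The trajectory that stays constant after the given initial path. -/
def stoppedPath {H : Type*} (n : ℕ) (a : Fin (n + 1) → H) (t : ℕ) : H :=
  a ⟨min t n, by omega⟩


lemma stoppedPath_initialPath {Ω H : Type*} {η : ℕ → Ω → H} {n t : ℕ} (ht : t ≤ n) (ω : Ω) :
    stoppedPath n (initialPath η n ω) t = η t ω := by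
  simp [stoppedPath, initialPath, ht]

lemma stoppedPath_of_le {H : Type*} {n t : ℕ} (ht : t ≤ n) (a : Fin (n + 1) → H) :
    stoppedPath n a t = a ⟨t, by omega⟩ := by
  simp [stoppedPath, ht]

lemma initialPath_preimage_singleton {Ω H : Type*} (η : ℕ → Ω → H) (n : ℕ) (a : Fin (n + 1) → H) :
    initialPath η n ⁻¹' {a} = {ω | ∀ t ≤ n, η t ω = stoppedPath n a t} := by
  ext ω
  simp only [mem_preimage, mem_singleton_iff, mem_ofPred_eq, funext_iff, initialPath]
  constructor
  · intro h t ht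
    rw [stoppedPath_of_le ht]
    exact h ⟨t, by omega⟩
  · intro h i
    rw [h i (by omega), stoppedPath_of_le (by omega)]

/-- The martingale part of the additive functional `∑ (u - ϖ u)(η t)`. -/
def martingalePart (ϖ : Matrix H H ℝ) (u : H → ℝ) (y : ℕ → H) (n : ℕ) : ℝ :=
  ∑ t ∈ Finset.range n, (u (y (t + 1)) - ϖ.mulVec u (y t))

/-- Depending only on the first `n + 1` states, the martingale is a function on a finite path space;
its integrability and its expectations reduce to finite sums. -/
lemma martingalePart_eq_initialPath (ϖ : Matrix H H ℝ) (u : H → ℝ) (η : ℕ → Ω → H) (n : ℕ) (ω : Ω) :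
    martingalePart ϖ u (fun t => η t ω) n =
      martingalePart ϖ u (stoppedPath n (initialPath η n ω)) n :=
  Finset.sum_congr rfl fun t ht => by
    have := Finset.mem_range.1 ht
    rw [stoppedPath_initialPath (by omega), stoppedPath_initialPath (by omega)]

namespace IsMarkovChain

lemma measurable_initialPath (hη : IsMarkovChain P ϖ h₁ η) (n : ℕ) :
    Measurable (initialPath η n) :=
  measurable_pi_lambda _ fun i => hη.measurable i

lemma measureReal_succ (hη : IsMarkovChain P ϖ h₁ η) (hϖ : ∀ i j, 0 ≤ ϖ i j) (n : ℕ)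
    (a : ℕ → H) :
    P.real {ω | ∀ t ≤ n + 1, η t ω = a t} =
      P.real {ω | ∀ t ≤ n, η t ω = a t} * ϖ (a n) (a (n + 1)) := by
  simp only [measureReal_def, hη.law, Finset.prod_range_succ, ← mul_assoc, ENNReal.toReal_mul,
    ENNReal.toReal_ofReal (hϖ _ _)]

lemma measureReal_snoc (hη : IsMarkovChain P ϖ h₁ η) (hϖ : ∀ i j, 0 ≤ ϖ i j) (n : ℕ)
    (b : Fin (n + 1) → H) (d : H) :
    P.real (initialPath η (n + 1) ⁻¹' {Fin.snoc (α := fun _ => H) b d}) =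
      P.real (initialPath η n ⁻¹' {b}) * ϖ (b (Fin.last n)) d := by
  rw [initialPath_preimage_singleton, initialPath_preimage_singleton, hη.measureReal_succ hϖ]
  have h (t : ℕ) (ht : t ≤ n) :
      stoppedPath (n + 1) (Fin.snoc (α := fun _ => H) b d) t = b ⟨t, by omega⟩ := by
    rw [stoppedPath_of_le (by omega)]
    exact Fin.snoc_castSucc (α := fun _ => H) d b ⟨t, by omega⟩
  congr 1
  · congr 1
    ext ω
    refine forall₂_congr fun t ht => ?_
    rw [h t ht, stoppedPath_of_le ht]
  · rw [h n le_rfl, stoppedPath_of_le le_rfl]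
    congr 1
    exact Fin.snoc_last (α := fun _ => H) d b

lemma integral_comp_initialPath (hη : IsMarkovChain P ϖ h₁ η) (n : ℕ)
    (K : (Fin (n + 1) → H) → ℝ) :
    ∫ ω, K (initialPath η n ω) ∂P = ∑ a, P.real (initialPath η n ⁻¹' {a}) * K a := by
  have hm := hη.measurable_initialPath n
  have : IsProbabilityMeasure (P.map (initialPath η n)) :=
    Measure.isProbabilityMeasure_map hm.aemeasurable
  rw [← integral_map (φ := initialPath η n) hm.aemeasurable
    (measurable_of_finite K).aestronglyMeasurable, integral_fintype .of_finite]
  simp [map_measureReal_apply hm (measurableSet_singleton _)]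

/-- One-step transitions are centred at their conditional mean. -/
lemma integral_mul_sub_eq_zero (hη : IsMarkovChain P ϖ h₁ η)
    (hϖ : ϖ ∈ Matrix.rowStochastic ℝ H) (n : ℕ) (F : (Fin (n + 1) → H) → ℝ) (u : H → ℝ) :
    ∫ ω, F (initialPath η n ω) * (u (η (n + 1) ω) - ϖ.mulVec u (η n ω)) ∂P = 0 := by
  have h1 := hη.integral_comp_initialPath (n + 1) fun a =>
    F (Fin.init a) * (u (a (Fin.last (n + 1))) - ϖ.mulVec u (a (Fin.last n).castSucc))
  have h2 (ω : Ω) : Fin.init (initialPath η (n + 1) ω) = initialPath η n ω := rfl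
  have h3 (ω : Ω) : initialPath η (n + 1) ω (Fin.last (n + 1)) = η (n + 1) ω := rfl
  have h4 (ω : Ω) : initialPath η (n + 1) ω (Fin.last n).castSucc = η n ω := rfl
  simp only [h2, h3, h4] at h1
  -- Split each path into a prefix `b` and a last state `d`; for fixed `b` the sum over `d` is
  -- centred.
  rw [h1, ← (Fin.snocEquiv fun _ => H).sum_comp, Fintype.sum_prod_type_right]
  refine Finset.sum_eq_zero fun b _ => ?_
  have h5 (d : H) : Fin.snocEquiv (fun _ : Fin (n + 2) => H) (d, b) =
    Fin.snoc (α := fun _ => H) b d := rfl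
  simp only [h5, hη.measureReal_snoc hϖ.1, Fin.init_snoc, Fin.snoc_last, Fin.snoc_castSucc]
  have h6 : ∑ d, ϖ (b (Fin.last n)) d * (u d - ϖ.mulVec u (b (Fin.last n))) = 0 := by
    simp only [mul_sub, Finset.sum_sub_distrib, ← Finset.sum_mul,
      Matrix.sum_row_of_mem_rowStochastic hϖ, one_mul]
    exact sub_self _
  calc _ = P.real (initialPath η n ⁻¹' {b}) * F b *
        ∑ d, ϖ (b (Fin.last n)) d * (u d - ϖ.mulVec u (b (Fin.last n))) := by
        rw [Finset.mul_sum]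
        exact Finset.sum_congr rfl fun d _ => by ring
    _ = 0 := by rw [h6, mul_zero]

lemma integrable_comp_initialPath (hη : IsMarkovChain P ϖ h₁ η) (n : ℕ)
    (K : (Fin (n + 1) → H) → ℝ) : Integrable (fun ω => K (initialPath η n ω)) P :=
  have := Measure.isProbabilityMeasure_map (μ := P) (hη.measurable_initialPath n).aemeasurable
  (Integrable.of_finite (μ := P.map (initialPath η n)) (f := K)).comp_measurable
    (hη.measurable_initialPath n)

lemma integrable_martingalePart_sq (hη : IsMarkovChain P ϖ h₁ η) (u : H → ℝ) (n : ℕ) :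
    Integrable (fun ω => martingalePart ϖ u (fun t => η t ω) n ^ 2) P := by
  simp only [martingalePart_eq_initialPath (η := η)]
  exact hη.integrable_comp_initialPath n fun a => martingalePart ϖ u (stoppedPath n a) n ^ 2

/-- Each increment is orthogonal to the past, so the cross terms drop out, and its square is bounded
because `H` is finite. -/
lemma exists_integral_martingalePart_sq_le (hη : IsMarkovChain P ϖ h₁ η)
    (hϖ : ϖ ∈ Matrix.rowStochastic ℝ H) (u : H → ℝ) :
    ∃ C : ℝ, ∀ n : ℕ, ∫ ω, martingalePart ϖ u (fun t => η t ω) n ^ 2 ∂P ≤ C * n := by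
  obtain ⟨C, hC⟩ := (Set.finite_range fun z : H × H => (u z.2 - ϖ.mulVec u z.1) ^ 2).bddAbove
  have hC (i j : H) : (u j - ϖ.mulVec u i) ^ 2 ≤ C := hC ⟨(i, j), rfl⟩
  refine ⟨C, fun n => ?_⟩
  induction n with
  | zero => simp [martingalePart]
  | succ n ih =>
    have h1 (ω : Ω) : martingalePart ϖ u (fun t => η t ω) (n + 1) ^ 2 =
        martingalePart ϖ u (fun t => η t ω) n ^ 2 +
        2 * (martingalePart ϖ u (fun t => η t ω) n *
          (u (η (n + 1) ω) - ϖ.mulVec u (η n ω))) +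
        (u (η (n + 1) ω) - ϖ.mulVec u (η n ω)) ^ 2 := by
      simp only [martingalePart, Finset.sum_range_succ]
      ring
    have h2 := hη.integral_mul_sub_eq_zero hϖ n
      (fun a => martingalePart ϖ u (stoppedPath n a) n) u
    simp only [← martingalePart_eq_initialPath] at h2
    have i1 := hη.integrable_martingalePart_sq u n
    have i2 : Integrable (fun ω => martingalePart ϖ u (fun t => η t ω) n *
          (u (η (n + 1) ω) - ϖ.mulVec u (η n ω))) P := by
      simp only [martingalePart_eq_initialPath (η := η)]
      exact hη.integrable_comp_initialPath (n + 1) fun a => martingalePart ϖ u (stoppedPath n (Fin.init a)) n *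
        (u (a (Fin.last (n + 1))) - ϖ.mulVec u (a (Fin.last n).castSucc))
    have i3 : Integrable (fun ω => (u (η (n + 1) ω) - ϖ.mulVec u (η n ω)) ^ 2) P :=
      hη.integrable_comp_initialPath (n + 1) fun a =>
        (u (a (Fin.last (n + 1))) - ϖ.mulVec u (a (Fin.last n).castSucc)) ^ 2
    have h3 : ∫ ω, (u (η (n + 1) ω) - ϖ.mulVec u (η n ω)) ^ 2 ∂P ≤ C := by
      simpa using integral_mono i3 (integrable_const C) fun ω => hC _ _
    simp only [h1]
    have i12 := i1.add (i2.const_mul 2)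
    simp only [Pi.add_def] at i12
    rw [integral_add i12 i3, integral_add i1 (i2.const_mul 2), integral_const_mul, h2]
    push_cast
    linarith

/-- Ergodic theorem for an irreducible finite chain: empirical frequencies converge to the
stationary probabilities. -/
theorem ae_tendsto_count_div (hη : IsMarkovChain P ϖ h₁ η)
    (hϖ : ϖ ∈ Matrix.rowStochastic ℝ H) (hirr : ϖ.IsIrreducible)
    {ν : H → ℝ} (hν : IsStationary ϖ ν) :
    ∀ᵐ ω ∂P, ∀ h, Tendsto (fun n : ℕ => (Nat.count (fun t => η t ω = h) n : ℝ) / n) atTop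
      (𝓝 (ν h)) := by
  refine ae_all_iff.2 fun h => ?_
  -- The indicator of `h`, centred under `ν`, is the right-hand side of the Poisson equation.
  have hg : ν ⬝ᵥ (Pi.single h 1 - fun _ => ν h) = 0 := by
    have h1 : ∑ i, ν i = 1 := hν.1.2
    rw [dotProduct_sub, dotProduct_single_one]
    simp [dotProduct, ← Finset.sum_mul, h1]
  obtain ⟨u, hu⟩ := exists_sub_mulVec_eq hϖ hirr hν hg
  obtain ⟨C, hC⟩ := hη.exists_integral_martingalePart_sq_le hϖ u
  obtain ⟨B, hB⟩ := (Set.finite_range fun z : H × H => |u z.1 - u z.2|).bddAbove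
  have hB (i j : H) : |u i - u j| ≤ B := hB ⟨(i, j), rfl⟩
  -- Replacing `ϖ u (y t)` by `u (y (t + 1))` makes the sum telescope; the error is the martingale.
  have hcount (y : ℕ → H) (n : ℕ) : (Nat.count (fun t => y t = h) n : ℝ) =
      n * ν h + (u (y 0) - u (y n)) + martingalePart ϖ u y n := by
    induction n with
    | zero => simp [martingalePart]
    | succ n ih =>
      have h1 := congrFun hu (y n)
      simp only [Pi.sub_apply, Pi.single_apply] at h1
      rw [Nat.count_succ, Nat.cast_add, ih, martingalePart, martingalePart, Finset.sum_range_succ]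
      split_ifs at h1 ⊢ <;> push_cast <;> linarith
  have hint (n : ℕ) : Integrable (fun ω => (martingalePart ϖ u (fun t => η t ω) n / n) ^ 2) P := by
    simp only [div_pow]
    exact (hη.integrable_martingalePart_sq u n).div_const _
  have hle (n : ℕ) : ∫ ω, (martingalePart ϖ u (fun t => η t ω) n / n) ^ 2 ∂P ≤ C / n := by
    simp only [div_pow, integral_div]
    refine (div_le_div_of_nonneg_right (hC n) (by positivity)).trans_eq ?_
    rcases eq_or_ne (n : ℝ) 0 with h0 | h0
    · simp [h0]
    · field_simp
  -- The bound `C / n` is summable along squares, though in general not along all `n`.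
  have hsum : Summable fun k : ℕ =>
      ∫ ω, (martingalePart ϖ u (fun t => η t ω) (k ^ 2) / (k ^ 2 : ℕ)) ^ 2 ∂P := by
    refine Summable.of_nonneg_of_le (fun k => integral_nonneg fun ω => sq_nonneg _)
      (fun k => hle (k ^ 2)) ?_
    have := (Real.summable_one_div_nat_pow.2 one_lt_two).mul_left C
    simpa [div_eq_mul_inv] using this
  filter_upwards [ae_tendsto_zero_of_summable_integral (fun _ _ => sq_nonneg _)
    (fun k => hint (k ^ 2)) hsum] with ω hω
  refine tendsto_div_of_monotone_of_tendsto_div_sq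
    (fun m n hmn => Nat.cast_le.2 (Nat.count_monotone _ hmn)) ?_
  have h1 : Tendsto (fun k : ℕ => martingalePart ϖ u (fun t => η t ω) (k ^ 2) / (k ^ 2 : ℕ))
      atTop (𝓝 0) := by
    have h2 := (Real.continuous_sqrt.tendsto 0).comp hω
    simp only [Function.comp_def, Real.sqrt_sq_eq_abs, Real.sqrt_zero] at h2
    exact tendsto_zero_iff_abs_tendsto_zero _ |>.2 h2
  have hsq : Tendsto (fun k : ℕ => ((k ^ 2 : ℕ) : ℝ)) atTop atTop :=
    tendsto_natCast_atTop_atTop.comp (tendsto_pow_atTop two_ne_zero)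
  have h3 : Tendsto (fun k : ℕ => (u (η 0 ω) - u (η (k ^ 2) ω)) / (k ^ 2 : ℕ)) atTop (𝓝 0) := by
    refine squeeze_zero_norm (fun k => ?_) (tendsto_const_nhds.div_atTop hsq : Tendsto
      (fun k : ℕ => B / ((k ^ 2 : ℕ) : ℝ)) atTop (𝓝 0))
    rw [Real.norm_eq_abs, abs_div, Nat.abs_cast]
    exact div_le_div_of_nonneg_right (hB _ _) (by positivity)
  have h4 : Tendsto (fun k : ℕ => ν h + (u (η 0 ω) - u (η (k ^ 2) ω)) / (k ^ 2 : ℕ) +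
      martingalePart ϖ u (fun t => η t ω) (k ^ 2) / (k ^ 2 : ℕ)) atTop (𝓝 (ν h)) := by
    simpa using (h3.const_add (ν h)).add h1
  refine h4.congr' ?_
  filter_upwards [eventually_gt_atTop 0] with k hk
  rw [hcount (fun t => η t ω)]
  have : ((k ^ 2 : ℕ) : ℝ) ≠ 0 := by positivity
  field_simp

end IsMarkovChain
end MarkovChain

/-! ### A Banach-valued strong law given the context sequence. -/

section StrongLaw

set_option linter.unusedSectionVars false

variable {H X : Type*} [Fintype H] [DecidableEq H] [MeasurableSpace H]
  [MeasurableSingletonClass H] [MeasurableSpace X]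

/-- Laws of processes with one finite-valued coordinate are determined by the finite-dimensional
distributions in which the finite-valued coordinate is fixed. -/
lemma measure_ext_of_initialPath {μ ν : Measure (ℕ → H × X)} [IsProbabilityMeasure μ]
    [IsProbabilityMeasure ν]
    (h : ∀ (n : ℕ) (a : ℕ → H) (A : ℕ → Set X), (∀ t, MeasurableSet (A t)) →
      μ {z | ∀ t ≤ n, (z t).1 = a t ∧ (z t).2 ∈ A t} =
        ν {z | ∀ t ≤ n, (z t).1 = a t ∧ (z t).2 ∈ A t}) : μ = ν := by
  refine ext_of_generate_finite _ generateFrom_squareCylinders.symm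
    (isPiSystem_squareCylinders (fun _ => MeasurableSpace.isPiSystem_measurableSet)
      fun _ => by simp) ?_ (by simp)
  rintro _ ⟨s, B, hB, rfl⟩
  have hB (t : ℕ) : MeasurableSet (B t) := hB t (mem_univ t)
  set n := s.sup id with hn
  have hsn : ∀ t ∈ s, t ≤ n := fun t ht => Finset.le_sup (f := id) ht
  let B' : ℕ → Set (H × X) := fun t => if t ∈ s then B t else univ
  have hB' (t : ℕ) : MeasurableSet (B' t) := by
    simp only [B']
    split_ifs
    exacts [hB t, .univ]
  have hS : (s : Set ℕ).pi B = {z | ∀ t ≤ n, z t ∈ B' t} := by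
    ext z
    simp only [Set.mem_pi, Finset.mem_coe, mem_ofPred_eq, B']
    refine ⟨fun hz t _ => ?_, fun hz t ht => by simpa [ht] using hz t (hsn t ht)⟩
    split_ifs with ht
    exacts [hz t ht, mem_univ _]
  have hSm : MeasurableSet ((s : Set ℕ).pi B) :=
    MeasurableSet.pi s.countable_toSet fun t _ => hB t
  let f : (ℕ → H × X) → (Fin (n + 1) → H) := initialPath (fun t z => (z t).1) n
  have hf : Measurable f := measurable_pi_lambda _ fun i => by
    simp only [f, initialPath]
    fun_prop
  -- Partition the cylinder by the finitely many initial context paths; on each piece `B' t` becomes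
  -- a condition on the `X`-coordinate alone.
  have key (ρ : Measure (ℕ → H × X)) : ρ ((s : Set ℕ).pi B) =
      ∑ b, ρ {z | ∀ t ≤ n, (z t).1 = stoppedPath n b t ∧
        (z t).2 ∈ Prod.mk (stoppedPath n b t) ⁻¹' B' t} := by
    have h1 := sum_measure_preimage_singleton (μ := ρ.restrict ((s : Set ℕ).pi B)) (f := f)
      Finset.univ fun b _ => hf (measurableSet_singleton b)
    rw [Finset.coe_univ, preimage_univ, Measure.restrict_apply_univ] at h1
    rw [← h1]
    refine Finset.sum_congr rfl fun b _ => ?_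
    rw [Measure.restrict_apply (hf (measurableSet_singleton b)),
      initialPath_preimage_singleton, hS]
    congr 1
    ext z
    simp only [mem_inter_iff, mem_ofPred_eq, mem_preimage]
    refine ⟨fun hz t ht => ⟨hz.1 t ht, ?_⟩, fun hz => ⟨fun t ht => (hz t ht).1, fun t ht => ?_⟩⟩
    · rw [← hz.1 t ht]
      exact hz.2 t ht
    · have := (hz t ht).2
      rwa [← (hz t ht).1] at this
  rw [key, key]
  exact Finset.sum_congr rfl fun b _ => h n _ _ fun t => measurable_prodMk_left (hB' t)

/-- Re-indexes a sum over time by successive visits, so that the i.i.d. strong law applies to the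
visits to one state. -/
lemma sum_range_ite_eq_sum_nth {E : Type*} [AddCommMonoid E] (p : ℕ → Prop) [DecidablePred p]
    (a : ℕ → E) (n : ℕ) :
    ∑ t ∈ Finset.range n, (if p t then a t else 0) =
      ∑ k ∈ Finset.range (Nat.count p n), a (Nat.nth p k) := by
  induction n with
  | zero => simp
  | succ n ih =>
    rw [Finset.sum_range_succ, ih, Nat.count_succ]
    split_ifs with h
    · rw [Finset.sum_range_succ, Nat.nth_count h]
    · simp

variable {E : Type*} [NormedAddCommGroup E] [NormedSpace ℝ E] [CompleteSpace E]
  [MeasurableSpace E] [BorelSpace E]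
  {Q : H → Measure X} [∀ h, IsProbabilityMeasure (Q h)] {g : H → X → E}

/-- Averages of an array of independent variables along injectively chosen rows of a column. -/
lemma ae_tendsto_average_comp_injective (hg : ∀ h, Measurable (g h))
    (hgi : ∀ h, Integrable (g h) (Q h)) (h : H) {τ : ℕ → ℕ} (hτ : Function.Injective τ) :
    ∀ᵐ x ∂(Measure.infinitePi fun i : ℕ × H => Q i.2),
      Tendsto (fun n : ℕ => (n : ℝ)⁻¹ • ∑ k ∈ Finset.range n, g h (x (τ k, h))) atTop
        (𝓝 (∫ z, g h z ∂(Q h))) := by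
  set ρ := Measure.infinitePi fun i : ℕ × H => Q i.2
  have hmp (k : ℕ) : MeasurePreserving (fun x : ℕ × H → X => x (τ k, h)) ρ (Q h) :=
    measurePreserving_eval_infinitePi (fun i : ℕ × H => Q i.2) (τ k, h)
  have hind := iIndepFun_infinitePi (P := fun i : ℕ × H => Q i.2) (X := fun _ => g h)
    fun _ => hg h
  have h1 := strong_law_ae (μ := ρ) (fun k x => g h (x (τ k, h)))
    ((hmp 0).integrable_comp_of_integrable (hgi h))
    (fun i j hij => hind.indepFun (i := (τ i, h)) (j := (τ j, h))
      (by simpa using hτ.ne hij))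
    (fun i => ⟨((hg h).comp (hmp i).measurable).aemeasurable,
      ((hg h).comp (hmp 0).measurable).aemeasurable, by
        have e (k : ℕ) : ρ.map (fun x => g h (x (τ k, h))) = (Q h).map (g h) := by
          rw [← (hmp k).map_eq, Measure.map_map (hg h) (hmp k).measurable]
          rfl
        rw [e, e]⟩)
  have h2 : ∫ x, g h (x (τ 0, h)) ∂ρ = ∫ z, g h z ∂(Q h) := by
    rw [← (hmp 0).map_eq, integral_map (hmp 0).measurable.aemeasurable]
    rw [(hmp 0).map_eq]
    exact (hgi h).aestronglyMeasurable
  rwa [h2] at h1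

/-- Strong law for an array of independent variables sampled along a path with given positive
frequencies. -/
lemma ae_tendsto_average_along_path (hg : ∀ h, Measurable (g h))
    (hgi : ∀ h, Integrable (g h) (Q h)) {ν : H → ℝ} (hν : ∀ h, 0 < ν h) {y : ℕ → H}
    (hy : ∀ h, Tendsto (fun n : ℕ => (Nat.count (fun t => y t = h) n : ℝ) / n) atTop
      (𝓝 (ν h))) :
    ∀ᵐ x ∂(Measure.infinitePi fun i : ℕ × H => Q i.2),
      Tendsto (fun n : ℕ => (n : ℝ)⁻¹ • ∑ t ∈ Finset.range n, g (y t) (x (t, y t))) atTop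
        (𝓝 (∑ h, ν h • ∫ z, g h z ∂(Q h))) := by
  have hcount (h : H) : Tendsto (fun n => Nat.count (fun t => y t = h) n) atTop atTop := by
    have h1 := (hy h).pos_mul_atTop (hν h) tendsto_natCast_atTop_atTop
    refine tendsto_natCast_atTop_iff (R := ℝ).1 (h1.congr' ?_)
    filter_upwards [eventually_gt_atTop 0] with n hn
    have : (n : ℝ) ≠ 0 := by positivity
    field_simp
  -- Infinitely many visits are needed for `Nat.nth` to be injective, so that distinct visits read
  -- distinct array entries.
  have hinf (h : H) : (Set.ofPred fun t => y t = h).Infinite := by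
    intro hfin
    obtain ⟨n, hn⟩ := ((hcount h).eventually_gt_atTop hfin.toFinset.card).exists
    rw [Nat.count_eq_card_filter_range] at hn
    refine absurd (Finset.card_le_card ?_) hn.not_ge
    intro t ht
    simpa using (Finset.mem_filter.1 ht).2
  have h1 := ae_all_iff.2 fun h => ae_tendsto_average_comp_injective hg hgi h
    (Nat.nth_injective (hinf h))
  filter_upwards [h1] with x hx
  have h2 : Tendsto (fun n : ℕ => ∑ h, ((Nat.count (fun t => y t = h) n : ℝ) / n) •
      ((Nat.count (fun t => y t = h) n : ℝ)⁻¹ •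
        ∑ k ∈ Finset.range (Nat.count (fun t => y t = h) n),
          g h (x (Nat.nth (fun t => y t = h) k, h)))) atTop
      (𝓝 (∑ h, ν h • ∫ z, g h z ∂(Q h))) :=
    tendsto_finsetSum _ fun h _ => (hy h).smul ((hx h).comp (hcount h))
  refine h2.congr fun n => ?_
  have h3 : ∑ t ∈ Finset.range n, g (y t) (x (t, y t)) =
      ∑ h, ∑ t ∈ Finset.range n, if y t = h then g h (x (t, h)) else 0 := by
    rw [Finset.sum_comm]
    simp
  rw [h3, Finset.smul_sum]
  refine Finset.sum_congr rfl fun h _ => ?_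
  rw [sum_range_ite_eq_sum_nth (fun t => y t = h) fun t => g h (x (t, h)), smul_smul]
  rcases eq_or_ne (Nat.count (fun t => y t = h) n) 0 with h0 | h0
  · simp [h0]
  · congr 1
    have : (Nat.count (fun t => y t = h) n : ℝ) ≠ 0 := by exact_mod_cast h0
    field_simp

/-- Strong law of large numbers, in a separable Banach space, for observations that are
conditionally independent given a finite-state context sequence with limiting frequencies. -/
theorem ae_tendsto_average [SecondCountableTopology E] {Ω : Type*} [MeasurableSpace Ω]
    {P : Measure Ω} [IsProbabilityMeasure P] {ξ : ℕ → Ω → X} {η : ℕ → Ω → H}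
    (hξ : ∀ t, Measurable (ξ t)) (hη : ∀ t, Measurable (η t))
    (hlaw : ∀ (n : ℕ) (a : ℕ → H) (A : ℕ → Set X), (∀ t, MeasurableSet (A t)) →
      P {ω | ∀ t ≤ n, η t ω = a t ∧ ξ t ω ∈ A t} =
        P {ω | ∀ t ≤ n, η t ω = a t} * ∏ t ∈ Finset.range (n + 1), Q (a t) (A t))
    {ν : H → ℝ} (hν : ∀ h, 0 < ν h)
    (hfreq : ∀ᵐ ω ∂P, ∀ h, Tendsto (fun n : ℕ => (Nat.count (fun t => η t ω = h) n : ℝ) / n)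
      atTop (𝓝 (ν h)))
    (hg : ∀ h, Measurable (g h)) (hgi : ∀ h, Integrable (g h) (Q h)) :
    ∀ᵐ ω ∂P, Tendsto (fun n : ℕ => (n : ℝ)⁻¹ • ∑ t ∈ Finset.range n, g (η t ω) (ξ t ω)) atTop
      (𝓝 (∑ h, ν h • ∫ z, g h z ∂(Q h))) := by
  let Z : Ω → ℕ → H × X := fun ω t => (η t ω, ξ t ω)
  have hZ : Measurable Z := measurable_pi_lambda _ fun t => (hη t).prodMk (hξ t)
  let Y : Ω → ℕ → H := fun ω t => η t ω
  have hY : Measurable Y := measurable_pi_lambda _ hη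
  -- Representation of the process: draw an independent entry for every pair (time, state),
  -- independently of the context path, and let `Φ` read the entry at the current state.
  let ρ := Measure.infinitePi fun i : ℕ × H => Q i.2
  let Φ : (ℕ → H) × (ℕ × H → X) → ℕ → H × X := fun z t => (z.1 t, z.2 (t, z.1 t))
  have hΦ : Measurable Φ := by
    refine measurable_pi_lambda _ fun t => Measurable.prodMk (by fun_prop) ?_
    have h1 : Measurable fun w : H × (ℕ × H → X) => w.2 (t, w.1) :=
      measurable_from_prod_countable_right fun h => measurable_pi_apply (t, h)
    exact h1.comp (f := fun z : (ℕ → H) × (ℕ × H → X) => (z.1 t, z.2)) (by fun_prop)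
  have : IsProbabilityMeasure (P.map Z) := Measure.isProbabilityMeasure_map hZ.aemeasurable
  have : IsProbabilityMeasure (P.map Y) := Measure.isProbabilityMeasure_map hY.aemeasurable
  have : IsProbabilityMeasure (((P.map Y).prod ρ).map Φ) :=
    Measure.isProbabilityMeasure_map hΦ.aemeasurable
  have hms (n : ℕ) (a : ℕ → H) (A : ℕ → Set X) (hA : ∀ t, MeasurableSet (A t)) :
      MeasurableSet {z : ℕ → H × X | ∀ t ≤ n, (z t).1 = a t ∧ (z t).2 ∈ A t} := by
    have : {z : ℕ → H × X | ∀ t ≤ n, (z t).1 = a t ∧ (z t).2 ∈ A t} =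
        (Iic n).pi fun t => {a t} ×ˢ A t := by
      ext z
      simp [Set.mem_pi, Set.mem_prod]
    rw [this]
    exact MeasurableSet.pi (Set.to_countable _) fun t _ =>
      (measurableSet_singleton _).prod (hA t)
  have hmap : P.map Z = ((P.map Y).prod ρ).map Φ := by
    refine measure_ext_of_initialPath fun n a A hA => ?_
    rw [Measure.map_apply hZ (hms n a A hA), Measure.map_apply hΦ (hms n a A hA)]
    -- With the path fixed to `a`, only the distinct entries `(t, a t)` matter, so the event is a
    -- rectangle and its probability factors.
    have e1 : Φ ⁻¹' {z | ∀ t ≤ n, (z t).1 = a t ∧ (z t).2 ∈ A t} =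
        {y | ∀ t ≤ n, y t = a t} ×ˢ
          Set.pi ((Finset.range (n + 1)).image fun t => (t, a t)) fun i => A i.1 := by
      ext z
      simp only [Φ, mem_preimage, mem_ofPred_eq, Set.mem_prod, Set.mem_pi, Finset.coe_image,
        Set.mem_image, Finset.coe_range, Set.mem_Iio, forall_exists_index, and_imp]
      refine ⟨fun hz => ⟨fun t ht => (hz t ht).1, ?_⟩, fun hz t ht => ⟨hz.1 t ht, ?_⟩⟩
      · rintro _ t ht rfl
        have := hz t (by omega)
        rw [← this.1]
        exact this.2
      · rw [hz.1 t ht]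
        exact hz.2 _ t (by omega) rfl
    have hpath : MeasurableSet {y : ℕ → H | ∀ t ≤ n, y t = a t} := by
      have : {y : ℕ → H | ∀ t ≤ n, y t = a t} = (Iic n).pi fun t => {a t} := by
        ext z
        simp [Set.mem_pi]
      rw [this]
      exact MeasurableSet.pi (Set.to_countable _) fun t _ => measurableSet_singleton _
    rw [e1, Measure.prod_prod, Measure.map_apply hY hpath,
      Measure.infinitePi_pi _ fun i _ => hA i.1,
      Finset.prod_image fun s _ t _ hst => (Prod.mk.inj hst).1]
    exact hlaw n a A hA
  let p : (ℕ → H × X) → Prop := fun z =>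
    Tendsto (fun n : ℕ => (n : ℝ)⁻¹ • ∑ t ∈ Finset.range n, g (z t).1 (z t).2) atTop
      (𝓝 (∑ h, ν h • ∫ z, g h z ∂(Q h)))
  have hp : MeasurableSet {z | p z} := by
    refine measurableSet_tendsto _ fun n => Measurable.const_smul
      (Finset.measurable_sum _ fun t _ => ?_) _
    have h1 : Measurable fun w : H × X => g w.1 w.2 :=
      measurable_from_prod_countable_right fun h => hg h
    exact h1.comp (measurable_pi_apply t)
  refine ae_of_ae_map (p := p) hZ.aemeasurable ?_
  -- Fubini reduces the claim to almost every fixed context path, where only the array is random.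
  rw [hmap, ae_map_iff hΦ.aemeasurable hp, Measure.ae_prod_iff_ae_ae (p := fun x => p (Φ x)) (hΦ hp)]
  have hfm : MeasurableSet {y : ℕ → H | ∀ h, Tendsto (fun n : ℕ =>
      (Nat.count (fun t => y t = h) n : ℝ) / n) atTop (𝓝 (ν h))} := by
    have : {y : ℕ → H | ∀ h, Tendsto (fun n : ℕ =>
      (Nat.count (fun t => y t = h) n : ℝ) / n) atTop (𝓝 (ν h))} = ⋂ h, {y : ℕ → H |
        Tendsto (fun n : ℕ => (Nat.count (fun t => y t = h) n : ℝ) / n) atTop (𝓝 (ν h))} := by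
      ext; simp
    rw [this]
    refine MeasurableSet.iInter fun h => measurableSet_tendsto _ fun n => ?_
    refine Measurable.div_const ?_ _
    simp only [Nat.count_eq_card_filter_range, Finset.card_filter, Nat.cast_sum]
    exact Finset.measurable_sum _ fun t _ =>
      (measurable_of_finite fun i : H => (((if i = h then 1 else 0) : ℕ) : ℝ)).comp
        (measurable_pi_apply t)
  filter_upwards [(ae_map_iff hY.aemeasurable hfm).2 hfreq] with y hy
  exact ae_tendsto_average_along_path hg hgi hν hy

end StrongLaw

/-! ### Densities and the stationary mixture. -/

section DensityMeasure

variable {X : Type*} [MeasureSpace X] {g : X → ℝ}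

/-- A non-integrable function would have integral `0` by convention, not `1`. -/
lemma IsDensity.integrable (hg : IsDensity g) : Integrable g := by
  by_contra h
  exact zero_ne_one ((integral_undef h).symm.trans hg.integral_eq_one)

lemma IsDensity.isProbabilityMeasure (hg : IsDensity g) :
    IsProbabilityMeasure (densityMeasure g) := by
  constructor
  rw [densityMeasure, withDensity_apply _ .univ, Measure.restrict_univ,
    ← ofReal_integral_eq_lintegral_ofReal hg.integrable (ae_of_all _ hg.nonneg),
    hg.integral_eq_one, ENNReal.ofReal_one]

variable {H : Type*} [Fintype H] [MeasurableSpace H] {ν : H → ℝ} {q : H → X → ℝ}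

/-- Every component has positive weight, so a null set of the mixture is null for each component. -/
lemma ae_stationaryLaw_imp (hν : ∀ h, 0 < ν h) {p : X × H → Prop}
    (hp : ∀ᵐ z ∂(stationaryLaw ν q), p z) (h : H) : ∀ᵐ x ∂(densityMeasure (q h)), p (x, h) := by
  rw [ae_iff, stationaryLaw, Measure.finsetSum_apply, Finset.sum_eq_zero_iff] at hp
  have h1 : ∀ᵐ z ∂(ENNReal.ofReal (ν h) • (densityMeasure (q h)).map fun x => (x, h)), p z :=
    ae_iff.2 (hp h (Finset.mem_univ h))
  rw [Measure.ae_ennreal_smul_measure_iff (by simpa using hν h)] at h1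
  exact ae_of_ae_map (by fun_prop) h1

lemma integrable_stationaryLaw_iff [MeasurableSingletonClass H] (hν : ∀ h, 0 < ν h) {E : Type*}
    [NormedAddCommGroup E] {F : X × H → E} :
    Integrable F (stationaryLaw ν q) ↔
      ∀ h, Integrable (fun x => F (x, h)) (densityMeasure (q h)) := by
  rw [stationaryLaw, integrable_finsetSum_measure]
  simp only [Finset.mem_univ, true_imp_iff]
  refine forall_congr' fun h => ?_
  rw [integrable_smul_measure (by simpa using hν h) ENNReal.ofReal_ne_top,
    (measurableEmbedding_prod_mk_right h).integrable_map_iff]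
  rfl

lemma integral_stationaryLaw [MeasurableSingletonClass H] (hν : ∀ h, 0 < ν h) {F : X × H → ℝ}
    (hF : Integrable F (stationaryLaw ν q)) :
    ∫ z, F z ∂(stationaryLaw ν q) = ∑ h, ν h * ∫ x, F (x, h) ∂(densityMeasure (q h)) := by
  rw [stationaryLaw, integrable_finsetSum_measure] at hF
  rw [stationaryLaw, integral_finsetSum_measure hF]
  refine Finset.sum_congr rfl fun h _ => ?_
  rw [integral_smul_measure, (measurableEmbedding_prod_mk_right h).integral_map,
    ENNReal.toReal_ofReal (hν h).le, smul_eq_mul]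

end DensityMeasure

/-! ### Measurability of maps into `C(K, ℝ)`. -/

section ContinuousMap

/-- The sup distance to a fixed function is determined on a countable dense subset of `K`, and by
separability of `C(K, ℝ)` the balls generate its Borel sets. -/
lemma measurable_continuousMap_of_eval {X K : Type*} [MeasurableSpace X] [MetricSpace K]
    [CompactSpace K] [MeasurableSpace C(K, ℝ)] [BorelSpace C(K, ℝ)] {F : X → C(K, ℝ)}
    (hF : ∀ k, Measurable fun x => F x k) : Measurable F := by
  have hdist (c : C(K, ℝ)) : Measurable fun x => dist (F x) c := by
    refine measurable_of_Iic fun r => ?_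
    rcases lt_or_ge r 0 with hr | hr
    · convert MeasurableSet.empty
      ext x
      simpa using hr.trans_le dist_nonneg
    · obtain ⟨D, hDc, hD⟩ := TopologicalSpace.exists_countable_dense K
      have : (fun x => dist (F x) c) ⁻¹' Iic r =
          ⋂ k ∈ D, (fun x => dist (F x k) (c k)) ⁻¹' Iic r := by
        ext x
        simp only [mem_preimage, mem_Iic, mem_iInter, ContinuousMap.dist_le hr]
        refine ⟨fun h k _ => h k, fun h k => ?_⟩
        have hcl : IsClosed {k | dist (F x k) (c k) ≤ r} :=
          isClosed_le (by fun_prop) continuous_const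
        exact hcl.closure_subset_iff.2 h (hD k)
      rw [this]
      exact .biInter hDc fun k _ => ((hF k).dist measurable_const) measurableSet_Iic
  have hb : TopologicalSpace.IsTopologicalBasis
      {s : Set C(K, ℝ) | ∃ c r, s = Metric.ball c r} := by
    refine TopologicalSpace.isTopologicalBasis_of_isOpen_of_nhds ?_ fun c U hc hU => ?_
    · rintro _ ⟨c, r, rfl⟩
      exact Metric.isOpen_ball
    · obtain ⟨r, hr, hrU⟩ := Metric.isOpen_iff.1 hU c hc
      exact ⟨_, ⟨c, r, rfl⟩, Metric.mem_ball_self hr, hrU⟩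
  have hborel : ‹MeasurableSpace C(K, ℝ)› = borel _ := BorelSpace.measurable_eq
  rw [hborel, hb.borel_eq_generateFrom]
  refine measurable_generateFrom ?_
  rintro _ ⟨c, r, rfl⟩
  exact hdist c measurableSet_Iio

end ContinuousMap

/-! ### Consequences of the finite-dimensional distributions. -/

section DataProcess

variable {Ω X H : Type*} [MeasurableSpace Ω] [MeasureSpace X] [MeasurableSpace H]
  [DecidableEq H] {P : Measure Ω} {ϖ : Matrix H H ℝ} {q : H → X → ℝ} {h₁ : H}
  {ξ : ℕ → Ω → X} {η : ℕ → Ω → H}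

lemma IsDataProcess.isMarkovChain (hd : IsDataProcess P ϖ q h₁ ξ η)
    (hq : ∀ h, IsDensity (q h)) : IsMarkovChain P ϖ h₁ η where
  measurable := hd.measurable_η
  law n a := by
    have _ h := (hq h).isProbabilityMeasure
    simpa using hd.law n a (fun _ => univ) fun _ => .univ

lemma IsDataProcess.law_eq_mul (hd : IsDataProcess P ϖ q h₁ ξ η)
    (hq : ∀ h, IsDensity (q h)) (n : ℕ) (a : ℕ → H) (A : ℕ → Set X)
    (hA : ∀ t, MeasurableSet (A t)) :
    P {ω | ∀ t ≤ n, η t ω = a t ∧ ξ t ω ∈ A t} =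
      P {ω | ∀ t ≤ n, η t ω = a t} *
        ∏ t ∈ Finset.range (n + 1), densityMeasure (q (a t)) (A t) := by
  rw [hd.law n a A hA, (hd.isMarkovChain hq).law n a]

/-- Almost surely, only transitions of positive probability occur. -/
lemma IsMarkovChain.ae_transition_pos [Fintype H] [MeasurableSingletonClass H]
    [IsProbabilityMeasure P] (hη : IsMarkovChain P ϖ h₁ η) (hϖ : ∀ i j, 0 ≤ ϖ i j) :
    ∀ᵐ ω ∂P, ∀ t, 0 < ϖ (η t ω) (η (t + 1) ω) := by
  refine ae_all_iff.2 fun t => ?_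
  have h1 (b : Fin (t + 2) → H) :
      ∀ᵐ ω ∂P, initialPath η (t + 1) ω = b → 0 < ϖ (η t ω) (η (t + 1) ω) := by
    by_cases hb : 0 < ϖ (stoppedPath (t + 1) b t) (stoppedPath (t + 1) b (t + 1))
    · refine ae_of_all _ fun ω hω => ?_
      rw [← hω, stoppedPath_initialPath (by omega), stoppedPath_initialPath le_rfl] at hb
      exact hb
    · have h0 := le_antisymm (not_lt.1 hb) (hϖ _ _)
      have h2 : P (initialPath η (t + 1) ⁻¹' {b}) = 0 := by
        rw [initialPath_preimage_singleton, hη.law, Finset.prod_range_succ, h0]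
        simp
      filter_upwards [measure_eq_zero_iff_ae_notMem.1 h2] with ω hω hω'
      exact absurd hω' hω
  filter_upwards [ae_all_iff.2 h1] with ω hω
  exact hω _ rfl

end DataProcess

/-! ### The population log-likelihood, state by state. -/

section LogLikelihood

variable {X H T : Type*} [MeasureSpace X] [MeasurableSpace H] [MeasurableSingletonClass H]
  [Fintype H] {q : H → X → ℝ} {Θ : Set T} {f : X → H → T → ℝ}

lemma integrable_log_of_envelope {ν : H → ℝ} (hν : ∀ h, 0 < ν h)
    (hf : ∀ θ ∈ Θ, ∀ h, IsDensity fun x => f x h θ)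
    {G : X × H → ℝ} (hG : Integrable G (stationaryLaw ν q))
    (hfG : ∀ᵐ z ∂(stationaryLaw ν q), ∀ θ ∈ Θ, |Real.log (f z.1 z.2 θ)| ≤ G z)
    {θ : T} (hθ : θ ∈ Θ) (h : H) :
    Integrable (fun x => Real.log (f x h θ)) (densityMeasure (q h)) := by
  refine ((integrable_stationaryLaw_iff hν).1 hG h).mono'
    (hf θ hθ h).measurable.log.aestronglyMeasurable ?_
  filter_upwards [ae_stationaryLaw_imp hν hfG h] with x hx using hx θ hθ

lemma psi_eq_sum {ν : H → ℝ} (hν : ∀ h, 0 < ν h)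
    (hf : ∀ θ ∈ Θ, ∀ h, IsDensity fun x => f x h θ)
    {G : X × H → ℝ} (hG : Integrable G (stationaryLaw ν q))
    (hfG : ∀ᵐ z ∂(stationaryLaw ν q), ∀ θ ∈ Θ, |Real.log (f z.1 z.2 θ)| ≤ G z)
    {θ : T} (hθ : θ ∈ Θ) :
    psi ν q f θ = ∑ h, ν h * ∫ x, Real.log (f x h θ) ∂(densityMeasure (q h)) := by
  rw [psi, integral_stationaryLaw hν]
  exact (integrable_stationaryLaw_iff hν).2 fun h => integrable_log_of_envelope hν hf hG hfG hθ h

end LogLikelihood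

/-! ### Uniform convergence of the averaged log-likelihood. -/

section UniformLaw

variable {Ω X H : Type*} [MeasurableSpace Ω] [MeasureSpace X] [MeasurableSpace H]
  [MeasurableSingletonClass H] [Fintype H] [DecidableEq H] {P : Measure Ω}
  [IsProbabilityMeasure P] {ϖ : Matrix H H ℝ} {q : H → X → ℝ} {h₁ : H}
  {ξ : ℕ → Ω → X} {η : ℕ → Ω → H} {T : Type*} [MetricSpace T] {Θ : Set T}
  {f : X → H → T → ℝ}

/-- The log-likelihood of one observation, as a continuous function of the parameter. -/
noncomputable def logLikelihood (hf_pos : ∀ x h, ∀ θ ∈ Θ, 0 < f x h θ) (hf_cont : ∀ x h, ContinuousOn (f x h) Θ)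
    (h : H) (x : X) : C(Θ, ℝ) where
  toFun θ := Real.log (f x h θ)
  continuous_toFun := (hf_cont x h).domRestrict.log fun θ => (hf_pos x h θ θ.2).ne'

/-- Uniform law of large numbers for the log-likelihood. -/
theorem exists_tendsto_average_logLikelihood (hΘ : IsCompact Θ)
    (hϖ : ϖ ∈ Matrix.rowStochastic ℝ H) (hirr : ϖ.IsIrreducible)
    (hq : ∀ h, IsDensity (q h)) (hd : IsDataProcess P ϖ q h₁ ξ η)
    {ν : H → ℝ} (hν : IsStationary ϖ ν) (hf : ∀ θ ∈ Θ, ∀ h, IsDensity fun x => f x h θ)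
    (hf_pos : ∀ x h, ∀ θ ∈ Θ, 0 < f x h θ) (hf_cont : ∀ x h, ContinuousOn (f x h) Θ)
    {G : X × H → ℝ} (hG : Integrable G (stationaryLaw ν q))
    (hfG : ∀ᵐ z ∂(stationaryLaw ν q), ∀ θ ∈ Θ, |Real.log (f z.1 z.2 θ)| ≤ G z) :
    ∃ L : C(Θ, ℝ), (∀ θ : Θ, L θ = psi ν q f θ) ∧ ∀ᵐ ω ∂P,
      TendstoUniformly (fun (n : ℕ) (θ : Θ) =>
        (n : ℝ)⁻¹ * ∑ t ∈ Finset.range n, Real.log (f (ξ t ω) (η t ω) θ)) L atTop := by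
  have : CompactSpace Θ := isCompact_iff_compactSpace.1 hΘ
  let _ : MeasurableSpace C(Θ, ℝ) := borel _
  have _ : BorelSpace C(Θ, ℝ) := ⟨rfl⟩
  have _ h := (hq h).isProbabilityMeasure
  have hpos := hν.pos hirr
  have hgm (h : H) : Measurable (logLikelihood hf_pos hf_cont h) :=
    measurable_continuousMap_of_eval fun θ => (hf θ θ.2 h).measurable.log
  -- Since `G` bounds `|log f|` for all `θ` at once, it bounds the sup norm; this gives Bochner
  -- integrability.
  have hgi (h : H) : Integrable (logLikelihood hf_pos hf_cont h) (densityMeasure (q h)) := by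
    refine ⟨(hgm h).aestronglyMeasurable, ContinuousMap.hasFiniteIntegral_of_bound _ _
      ((integrable_stationaryLaw_iff hpos).1 hG h).hasFiniteIntegral ?_⟩
    filter_upwards [ae_stationaryLaw_imp hpos hfG h] with x hx θ using hx θ θ.2
  refine ⟨∑ h, ν h • ∫ x, logLikelihood hf_pos hf_cont h x ∂(densityMeasure (q h)),
    fun θ => ?_, ?_⟩
  · rw [psi_eq_sum hpos hf hG hfG θ.2, ContinuousMap.sum_apply]
    refine Finset.sum_congr rfl fun h _ => ?_
    -- Evaluation at `θ` commutes with the Bochner integral, which identifies the limit with `ψ`.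
    rw [ContinuousMap.smul_apply, smul_eq_mul, ContinuousMap.integral_apply (hgi h)]
    rfl
  · filter_upwards [ae_tendsto_average hd.measurable_ξ hd.measurable_η (hd.law_eq_mul hq) hpos
      ((hd.isMarkovChain hq).ae_tendsto_count_div hϖ hirr hν) hgm hgi] with ω hω
    convert ContinuousMap.tendsto_iff_tendstoUniformly.1 hω using 3 with n θ
    simp only [ContinuousMap.smul_apply, ContinuousMap.sum_apply, smul_eq_mul]
    rfl

end UniformLaw

/-! ### Concentration of the posterior. -/

section Posterior

variable {X H : Type*} {d : ℕ} {ϖ : Matrix H H ℝ}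
  {f : X → H → EuclideanSpace ℝ (Fin d) → ℝ} {p : EuclideanSpace ℝ (Fin d) → ℝ}
  {Θ : Set (EuclideanSpace ℝ (Fin d))} {x : ℕ → X} {y : ℕ → H} {c₁ c₂ : ℝ}

/-- Isolates the transition factor, which is free of `θ` and cancels in the posterior. At `N = 0`
the likelihood still contains one factor `f`, hence `1 ≤ N`. -/
lemma likelihood_eq (ϖ : Matrix H H ℝ) (f : X → H → EuclideanSpace ℝ (Fin d) → ℝ)
    (x : ℕ → X) (y : ℕ → H) {N : ℕ} (hN : 1 ≤ N) (θ : EuclideanSpace ℝ (Fin d)) :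
    likelihood ϖ f x y N θ = (∏ i ∈ Finset.range (N - 1), ϖ (y i) (y (i + 1))) *
      ∏ i ∈ Finset.range N, f (x i) (y i) θ := by
  obtain ⟨n, rfl⟩ : ∃ n, N = n + 1 := ⟨N - 1, by omega⟩
  rw [likelihood, Finset.prod_mul_distrib, Finset.prod_range_succ', Nat.add_sub_cancel]
  ring

lemma prod_eq_exp_average {θ : EuclideanSpace ℝ (Fin d)} (hf_pos : ∀ x h, 0 < f x h θ)
    {N : ℕ} (hN : 1 ≤ N) :
    ∏ i ∈ Finset.range N, f (x i) (y i) θ =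
      Real.exp (N * ((N : ℝ)⁻¹ * ∑ t ∈ Finset.range N, Real.log (f (x t) (y t) θ))) := by
  have : (N : ℝ) ≠ 0 := by positivity
  rw [mul_inv_cancel_left₀ this, Real.exp_sum]
  exact Finset.prod_congr rfl fun i _ => (Real.exp_log (hf_pos _ _)).symm

lemma likelihood_pos (hf_pos : ∀ x h, ∀ θ ∈ Θ, 0 < f x h θ)
    (hy : ∀ t, 0 < ϖ (y t) (y (t + 1))) (N : ℕ) {θ : EuclideanSpace ℝ (Fin d)} (hθ : θ ∈ Θ) :
    0 < likelihood ϖ f x y N θ :=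
  mul_pos (hf_pos _ _ _ hθ) (Finset.prod_pos fun _ _ => mul_pos (hf_pos _ _ _ hθ) (hy _))

lemma continuousOn_likelihood (hf_cont : ∀ x h, ContinuousOn (f x h) Θ) (N : ℕ) :
    ContinuousOn (likelihood ϖ f x y N) Θ :=
  (hf_cont _ _).mul (continuousOn_finsetProd _ fun _ _ => (hf_cont _ _).mul continuousOn_const)

lemma integrableOn_likelihood_mul (hΘ : IsCompact Θ)
    (hp_meas : AEMeasurable p (volume.restrict Θ)) (hc₂ : 0 < c₂)
    (hp : ∀ θ ∈ Θ, c₂ ≤ p θ ∧ p θ ≤ c₁) (hf_cont : ∀ x h, ContinuousOn (f x h) Θ) (N : ℕ) :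
    IntegrableOn (fun θ => likelihood ϖ f x y N θ * p θ) Θ := by
  refine Integrable.mul_bdd (c := c₁) ((continuousOn_likelihood hf_cont N).integrableOn_compact hΘ)
    hp_meas.aestronglyMeasurable ?_
  refine (ae_restrict_iff' hΘ.measurableSet).2 (ae_of_all _ fun θ hθ => ?_)
  rw [Real.norm_eq_abs, abs_of_pos (hc₂.trans_le (hp θ hθ).1)]
  exact (hp θ hθ).2

lemma integral_likelihood_mul_pos (hΘ : IsCompact Θ) (hΘ0 : volume Θ ≠ 0)
    (hp_meas : AEMeasurable p (volume.restrict Θ)) (hc₂ : 0 < c₂)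
    (hp : ∀ θ ∈ Θ, c₂ ≤ p θ ∧ p θ ≤ c₁) (hf_cont : ∀ x h, ContinuousOn (f x h) Θ)
    (hf_pos : ∀ x h, ∀ θ ∈ Θ, 0 < f x h θ) (hy : ∀ t, 0 < ϖ (y t) (y (t + 1))) (N : ℕ) :
    0 < ∫ θ in Θ, likelihood ϖ f x y N θ * p θ := by
  have hpos (θ) (hθ : θ ∈ Θ) : 0 < likelihood ϖ f x y N θ * p θ :=
    mul_pos (likelihood_pos hf_pos hy N hθ) (hc₂.trans_le (hp θ hθ).1)
  rw [setIntegral_pos_iff_support_of_nonneg_ae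
    ((ae_restrict_iff' hΘ.measurableSet).2 (ae_of_all _ fun θ hθ => (hpos θ hθ).le))
    (integrableOn_likelihood_mul hΘ hp_meas hc₂ hp hf_cont N)]
  have hsupp : Θ ⊆ Function.support fun θ => likelihood ϖ f x y N θ * p θ :=
    fun θ hθ => (hpos θ hθ).ne'
  rw [inter_eq_right.2 hsupp]
  exact pos_iff_ne_zero.2 hΘ0

lemma isProbabilityMeasure_posterior (hΘ : IsCompact Θ) (hΘ0 : volume Θ ≠ 0)
    (hp_meas : AEMeasurable p (volume.restrict Θ)) (hc₂ : 0 < c₂)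
    (hp : ∀ θ ∈ Θ, c₂ ≤ p θ ∧ p θ ≤ c₁) (hf_cont : ∀ x h, ContinuousOn (f x h) Θ)
    (hf_pos : ∀ x h, ∀ θ ∈ Θ, 0 < f x h θ) (hy : ∀ t, 0 < ϖ (y t) (y (t + 1))) (N : ℕ) :
    IsProbabilityMeasure (posterior ϖ f p Θ x y N) := by
  have hZ := integral_likelihood_mul_pos hΘ hΘ0 hp_meas hc₂ hp hf_cont hf_pos hy (x := x) N
  constructor
  rw [posterior, withDensity_apply _ .univ, Measure.restrict_univ,
    ← ofReal_integral_eq_lintegral_ofReal]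
  · simp only [posteriorDensity]
    rw [integral_div, div_self hZ.ne', ENNReal.ofReal_one]
  · exact (integrableOn_likelihood_mul hΘ hp_meas hc₂ hp hf_cont N).div_const _
  · refine (ae_restrict_iff' hΘ.measurableSet).2 (ae_of_all _ fun θ hθ => ?_)
    exact div_nonneg (mul_pos (likelihood_pos hf_pos hy N hθ) (hc₂.trans_le (hp θ hθ).1)).le hZ.le

/-- If the averaged log-likelihood is at most `b` on `A` and at least `a` on `B`, then the
posterior mass of `A` is at most of order `exp (N (b - a))`. -/
lemma posterior_le (hΘ : IsCompact Θ)
    (hp_meas : AEMeasurable p (volume.restrict Θ)) (hc₂ : 0 < c₂)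
    (hp : ∀ θ ∈ Θ, c₂ ≤ p θ ∧ p θ ≤ c₁) (hf_cont : ∀ x h, ContinuousOn (f x h) Θ)
    (hf_pos : ∀ x h, ∀ θ ∈ Θ, 0 < f x h θ) (hy : ∀ t, 0 < ϖ (y t) (y (t + 1)))
    {A B : Set (EuclideanSpace ℝ (Fin d))} (hA : MeasurableSet A) (hB : MeasurableSet B)
    (hBΘ : B ⊆ Θ) (hB0 : volume B ≠ 0) {a b : ℝ} {N : ℕ} (hN : 1 ≤ N)
    (ha : ∀ θ ∈ B, a ≤ (N : ℝ)⁻¹ * ∑ t ∈ Finset.range N, Real.log (f (x t) (y t) θ))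
    (hb : ∀ θ ∈ Θ ∩ A, (N : ℝ)⁻¹ * ∑ t ∈ Finset.range N, Real.log (f (x t) (y t) θ) ≤ b) :
    posterior ϖ f p Θ x y N A ≤
      ENNReal.ofReal (c₁ / (c₂ * volume.real B) * Real.exp (N * (b - a))) * volume Θ := by
  have hBfin : volume B ≠ ⊤ := measure_ne_top_of_subset hBΘ hΘ.measure_lt_top.ne
  have hBpos : 0 < volume.real B := ENNReal.toReal_pos hB0 hBfin
  obtain ⟨θ₀, hθ₀⟩ : B.Nonempty := nonempty_of_measure_ne_zero hB0
  have hc₁ : 0 < c₁ := hc₂.trans_le ((hp θ₀ (hBΘ hθ₀)).1.trans (hp θ₀ (hBΘ hθ₀)).2)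
  set c := ∏ i ∈ Finset.range (N - 1), ϖ (y i) (y (i + 1)) with hc
  have hcpos : 0 < c := Finset.prod_pos fun _ _ => hy _
  have hlik (θ) (hθ : θ ∈ Θ) : likelihood ϖ f x y N θ = c * Real.exp (N *
      ((N : ℝ)⁻¹ * ∑ t ∈ Finset.range N, Real.log (f (x t) (y t) θ))) := by
    rw [likelihood_eq ϖ f x y hN, prod_eq_exp_average (fun x h => hf_pos x h θ hθ) hN]
  have hint := integrableOn_likelihood_mul (ϖ := ϖ) (x := x) (y := y) hΘ hp_meas hc₂ hp hf_cont N
  set Z := ∫ θ in Θ, likelihood ϖ f x y N θ * p θ with hZ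
  -- The normalizing constant is bounded below by its integral over `B` alone.
  have hZle : c * Real.exp (N * a) * c₂ * volume.real B ≤ Z := by
    calc c * Real.exp (N * a) * c₂ * volume.real B
        = ∫ _ in B, c * Real.exp (N * a) * c₂ := by
          rw [setIntegral_const, smul_eq_mul, mul_comm]
      _ ≤ ∫ θ in B, likelihood ϖ f x y N θ * p θ := by
          refine setIntegral_mono_on (integrableOn_const hBfin) (hint.mono_set hBΘ) hB
            fun θ hθ => ?_
          rw [hlik θ (hBΘ hθ)]
          have := ha θ hθ
          have := (hp θ (hBΘ hθ)).1
          gcongr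
      _ ≤ Z := by
          refine setIntegral_mono_set hint ?_ hBΘ.eventuallyLE
          exact (ae_restrict_iff' hΘ.measurableSet).2 (ae_of_all _ fun θ hθ =>
            (mul_pos (likelihood_pos hf_pos hy N hθ) (hc₂.trans_le (hp θ hθ).1)).le)
  have hZ0 : 0 < c * Real.exp (N * a) * c₂ * volume.real B := by positivity
  rw [posterior, withDensity_apply _ hA, Measure.restrict_restrict hA]
  calc ∫⁻ θ in A ∩ Θ, ENNReal.ofReal (posteriorDensity ϖ f p Θ x y N θ)
      ≤ ∫⁻ _ in A ∩ Θ, ENNReal.ofReal (c₁ / (c₂ * volume.real B) * Real.exp (N * (b - a))) := by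
        refine setLIntegral_mono' (hA.inter hΘ.measurableSet) fun θ hθ => ?_
        refine ENNReal.ofReal_le_ofReal ?_
        have h1 : likelihood ϖ f x y N θ * p θ ≤ c * Real.exp (N * b) * c₁ := by
          rw [hlik θ hθ.2]
          have := hb θ hθ.symm
          have := (hp θ hθ.2).2
          gcongr
          exact (hc₂.trans_le (hp θ hθ.2).1).le
        calc posteriorDensity ϖ f p Θ x y N θ
            ≤ c * Real.exp (N * b) * c₁ / (c * Real.exp (N * a) * c₂ * volume.real B) :=
              div_le_div₀ (by positivity) h1 hZ0 hZle
          _ = c₁ / (c₂ * volume.real B) * Real.exp (N * (b - a)) := by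
              rw [mul_sub, Real.exp_sub]
              field_simp
    _ ≤ _ := by
        rw [setLIntegral_const]
        gcongr
        exact inter_subset_right

/-- Posterior mass escapes from any set away from the maximizers of the limiting averaged
log-likelihood. -/
theorem tendsto_posterior_compl_thickening (hΘ : IsCompact Θ)
    (hp_meas : AEMeasurable p (volume.restrict Θ)) (hc₂ : 0 < c₂)
    (hp : ∀ θ ∈ Θ, c₂ ≤ p θ ∧ p θ ≤ c₁) (hf_cont : ∀ x h, ContinuousOn (f x h) Θ)
    (hf_pos : ∀ x h, ∀ θ ∈ Θ, 0 < f x h θ) (hy : ∀ t, 0 < ϖ (y t) (y (t + 1)))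
    {L : C(Θ, ℝ)} (hL : TendstoUniformly (fun (n : ℕ) (θ : Θ) =>
      (n : ℝ)⁻¹ * ∑ t ∈ Finset.range n, Real.log (f (x t) (y t) θ)) L atTop)
    {S : Set (EuclideanSpace ℝ (Fin d))}
    (hS : ∀ θ : Θ, (θ : EuclideanSpace ℝ (Fin d)) ∈ S ↔ ∀ θ' : Θ, L θ' ≤ L θ) (hSΘ : S ⊆ Θ)
    (hstar : ∀ r : ℝ, 0 < r → 0 < volume (Θ ∩ Metric.thickening r S)) {ε : ℝ} (hε : 0 < ε) :
    Tendsto (fun N => posterior ϖ f p Θ x y N {θ | ε ≤ Metric.infDist θ S}) atTop (𝓝 0) := by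
  have : CompactSpace Θ := isCompact_iff_compactSpace.1 hΘ
  obtain ⟨θs, hθsS⟩ : S.Nonempty := by
    obtain ⟨θ, hθ⟩ := nonempty_of_measure_ne_zero (hstar 1 one_pos).ne'
    obtain ⟨s, hs, -⟩ := Metric.mem_thickening_iff.1 hθ.2
    exact ⟨s, hs⟩
  have hmax := (hS ⟨θs, hSΘ hθsS⟩).1 hθsS
  set M := L ⟨θs, hSΘ hθsS⟩ with hM
  set A : Set (EuclideanSpace ℝ (Fin d)) := {θ | ε ≤ Metric.infDist θ S} with hAdef
  have hAc : IsClosed A := isClosed_le continuous_const (Metric.continuous_infDist_pt S)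
  -- a gap between the maximum and the values far from the maximizers
  obtain ⟨δ, hδ, hgap⟩ : ∃ δ > 0, ∀ θ : Θ, (θ : EuclideanSpace ℝ (Fin d)) ∈ A →
      L θ ≤ M - 4 * δ := by
    have hK : IsCompact ((↑) ⁻¹' A : Set Θ) := (hAc.preimage continuous_subtype_val).isCompact
    rcases ((↑) ⁻¹' A : Set Θ).eq_empty_or_nonempty with hemp | hne
    · exact ⟨1, one_pos, fun θ hθ => absurd (show θ ∈ ((↑) ⁻¹' A : Set Θ) from hθ) (by simp [hemp])⟩
    · obtain ⟨k, hkA, hk⟩ := hK.exists_isMaxOn hne L.continuous.continuousOn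
      have hlt : L k < M := by
        refine lt_of_le_of_ne (hmax k) fun heq => ?_
        have : (k : EuclideanSpace ℝ (Fin d)) ∈ S := (hS k).2 fun θ' => heq ▸ hmax θ'
        have h0 := Metric.infDist_zero_of_mem this
        have h1 : ε ≤ Metric.infDist (k : EuclideanSpace ℝ (Fin d)) S := hkA
        linarith
      refine ⟨(M - L k) / 4, by linarith, fun θ hθ => ?_⟩
      have : L θ ≤ L k := hk hθ
      linarith
  -- One radius `r` serves all maximizers, so `L ≥ M - δ` on the whole of `B`.
  obtain ⟨r, hr, hcont⟩ := Metric.uniformContinuous_iff.1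
    (CompactSpace.uniformContinuous_of_continuous L.continuous) δ hδ
  set B := Θ ∩ Metric.thickening r S with hBdef
  have hLB (θ : Θ) (hθ : (θ : EuclideanSpace ℝ (Fin d)) ∈ B) : M - δ ≤ L θ := by
    obtain ⟨s, hs, hd⟩ := Metric.mem_thickening_iff.1 hθ.2
    have h1 := hcont (a := θ) (b := ⟨s, hSΘ hs⟩) hd
    have h2 := (hS ⟨s, hSΘ hs⟩).1 hs ⟨θs, hSΘ hθsS⟩
    rw [Real.dist_eq] at h1
    linarith [(abs_lt.1 h1).1]
  have hBm : MeasurableSet B := hΘ.measurableSet.inter Metric.isOpen_thickening.measurableSet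
  -- With uniform error below `δ`, the averages are at least `M - 2 * δ` on `B` and at most `M - 3 *
  -- δ` on `Θ ∩ A`; the exponent is `-N * δ`.
  have hlim : Tendsto (fun N : ℕ => ENNReal.ofReal (c₁ / (c₂ * volume.real B) *
      Real.exp (N * ((M - 3 * δ) - (M - 2 * δ)))) * volume Θ) atTop (𝓝 0) := by
    have h1 : Tendsto (fun N : ℕ => Real.exp (N * ((M - 3 * δ) - (M - 2 * δ)))) atTop (𝓝 0) := by
      refine Real.tendsto_exp_atBot.comp ?_
      refine tendsto_natCast_atTop_atTop.atTop_mul_const_of_neg ?_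
      linarith
    have h2 := ENNReal.Tendsto.mul_const (b := volume Θ) (ENNReal.tendsto_ofReal
      (h1.const_mul (c₁ / (c₂ * volume.real B)))) (.inr hΘ.measure_lt_top.ne)
    simpa using h2
  refine tendsto_of_tendsto_of_tendsto_of_le_of_le' tendsto_const_nhds hlim
    (.of_forall fun _ => zero_le) ?_
  filter_upwards [Metric.tendstoUniformly_iff.1 hL δ hδ, eventually_ge_atTop 1] with N hNL hN
  refine posterior_le hΘ hp_meas hc₂ hp hf_cont hf_pos hy hAc.measurableSet hBm
    inter_subset_left (hstar r hr).ne' hN (fun θ hθ => ?_) fun θ hθ => ?_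
  · have h1 := hNL ⟨θ, hθ.1⟩
    rw [Real.dist_eq] at h1
    linarith [(abs_lt.1 h1).2, hLB ⟨θ, hθ.1⟩ hθ]
  · have h1 := hNL ⟨θ, hθ.1⟩
    rw [Real.dist_eq] at h1
    linarith [(abs_lt.1 h1).1, hgap ⟨θ, hθ.1⟩ hθ.2]

end Posterior

/-! ### Likelihood maximization as divergence minimization. -/

section KullbackLeibler

variable {X : Type*} [MeasureSpace X] {g k : X → ℝ}

lemma densityMeasure_absolutelyContinuous (hk : IsDensity k) (hk_pos : ∀ x, 0 < k x) :
    densityMeasure g ≪ densityMeasure k :=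
  (withDensity_absolutelyContinuous _ _).trans
    (withDensity_absolutelyContinuous' hk.measurable.ennreal_ofReal.aemeasurable
      (ae_of_all _ fun x => by simpa using hk_pos x))

variable [SigmaFinite (volume : Measure X)]

/-- The Radon-Nikodym derivative is `g / k`; its logarithm splits because `g` is nonzero almost
everywhere for its own measure. -/
lemma llr_densityMeasure (hg : IsDensity g) (hk : IsDensity k) (hk_pos : ∀ x, 0 < k x) :
    llr (densityMeasure g) (densityMeasure k) =ᵐ[densityMeasure g]
      fun x => Real.log (g x) - Real.log (k x) := by
  have _ := hg.isProbabilityMeasure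
  have h1 := (withDensity_absolutelyContinuous volume fun x => ENNReal.ofReal (g x)).ae_le
    (Measure.rnDeriv_withDensity_right (densityMeasure g) volume
      hk.measurable.ennreal_ofReal.aemeasurable
      (ae_of_all _ fun x => by simpa using hk_pos x) (ae_of_all _ fun x => ENNReal.ofReal_ne_top))
  have h2 := (withDensity_absolutelyContinuous volume fun x => ENNReal.ofReal (g x)).ae_le
    (Measure.rnDeriv_withDensity volume hg.measurable.ennreal_ofReal)
  have h3 : ∀ᵐ x ∂(densityMeasure g), ENNReal.ofReal (g x) ≠ 0 :=
    (ae_withDensity_iff hg.measurable.ennreal_ofReal).2 (ae_of_all _ fun x hx => hx)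
  filter_upwards [h1, h2, h3] with x hx1 hx2 hx3
  have hgx : 0 < g x := by simpa using hx3
  rw [llr, densityMeasure, densityMeasure]
  rw [densityMeasure] at hx1
  rw [hx1, hx2, ENNReal.toReal_mul, ENNReal.toReal_inv, ENNReal.toReal_ofReal hgx.le,
    ENNReal.toReal_ofReal (hk_pos x).le, Real.log_mul (inv_ne_zero (hk_pos x).ne') hgx.ne',
    Real.log_inv]
  ring

lemma integrable_llr_densityMeasure (hg : IsDensity g) (hk : IsDensity k) (hk_pos : ∀ x, 0 < k x)
    (hgi : Integrable (fun x => Real.log (g x)) (densityMeasure g))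
    (hki : Integrable (fun x => Real.log (k x)) (densityMeasure g)) :
    Integrable (llr (densityMeasure g) (densityMeasure k)) (densityMeasure g) :=
  (hgi.sub hki).congr (llr_densityMeasure hg hk hk_pos).symm

lemma toReal_klDiv_densityMeasure (hg : IsDensity g) (hk : IsDensity k) (hk_pos : ∀ x, 0 < k x)
    (hgi : Integrable (fun x => Real.log (g x)) (densityMeasure g))
    (hki : Integrable (fun x => Real.log (k x)) (densityMeasure g)) :
    (InformationTheory.klDiv (densityMeasure g) (densityMeasure k)).toReal =
      ∫ x, Real.log (g x) ∂(densityMeasure g) - ∫ x, Real.log (k x) ∂(densityMeasure g) := by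
  have _ := hg.isProbabilityMeasure
  have _ := hk.isProbabilityMeasure
  rw [InformationTheory.toReal_klDiv_of_measure_eq
    (densityMeasure_absolutelyContinuous hk hk_pos) (by simp),
    integral_congr_ae (llr_densityMeasure hg hk hk_pos), integral_sub hgi hki]

variable {H : Type*} [Fintype H] [MeasurableSpace H] [MeasurableSingletonClass H]
  {ν : H → ℝ} {q : H → X → ℝ} {T : Type*} {Θ : Set T} {f : X → H → T → ℝ}

/-- The maximizers of the population log-likelihood minimize the averaged Kullback-Leibler
divergence. -/
theorem thetaStar_eq_argmin_averagedKL (hν : ∀ h, 0 < ν h) (hq : ∀ h, IsDensity (q h))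
    (hf : ∀ θ ∈ Θ, ∀ h, IsDensity fun x => f x h θ)
    (hf_pos : ∀ x h, ∀ θ ∈ Θ, 0 < f x h θ)
    {G : X × H → ℝ} (hG : Integrable G (stationaryLaw ν q))
    (hfG : ∀ᵐ z ∂(stationaryLaw ν q), ∀ θ ∈ Θ, |Real.log (f z.1 z.2 θ)| ≤ G z)
    (hqi : ∀ h, Integrable (fun x => Real.log (q h x)) (densityMeasure (q h))) :
    thetaStar ν q f Θ = {θ ∈ Θ | ∀ θ' ∈ Θ, averagedKL ν q f θ ≤ averagedKL ν q f θ'} := by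
  have hfi {θ : T} (hθ : θ ∈ Θ) (h : H) := integrable_log_of_envelope hν hf hG hfG hθ h
  have htop {θ : T} (hθ : θ ∈ Θ) (h : H) : ENNReal.ofReal (ν h) * InformationTheory.klDiv
      (densityMeasure (q h)) (densityMeasure fun x => f x h θ) ≠ ⊤ :=
    ENNReal.mul_ne_top ENNReal.ofReal_ne_top (InformationTheory.klDiv_ne_top
      (densityMeasure_absolutelyContinuous (hf θ hθ h) fun x => hf_pos x h θ hθ)
      (integrable_llr_densityMeasure (hq h) (hf θ hθ h) (fun x => hf_pos x h θ hθ) (hqi h)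
        (hfi hθ h)))
  have hne {θ : T} (hθ : θ ∈ Θ) : averagedKL ν q f θ ≠ ⊤ :=
    ENNReal.sum_ne_top.2 fun h _ => htop hθ h
  -- The first term does not involve `θ`, so minimizing the divergence is maximizing `psi`.
  have hval {θ : T} (hθ : θ ∈ Θ) : (averagedKL ν q f θ).toReal =
      ∑ h, ν h * ∫ x, Real.log (q h x) ∂(densityMeasure (q h)) - psi ν q f θ := by
    rw [averagedKL, ENNReal.toReal_sum fun h _ => htop hθ h, psi_eq_sum hν hf hG hfG hθ,
      ← Finset.sum_sub_distrib]
    refine Finset.sum_congr rfl fun h _ => ?_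
    rw [ENNReal.toReal_mul, ENNReal.toReal_ofReal (hν h).le, toReal_klDiv_densityMeasure (hq h)
      (hf θ hθ h) (fun x => hf_pos x h θ hθ) (hqi h) (hfi hθ h), mul_sub]
  ext θ
  refine and_congr_right fun hθ => forall₂_congr fun θ' hθ' => ?_
  rw [← ENNReal.toReal_le_toReal (hne hθ) (hne hθ'), hval hθ, hval hθ']
  constructor <;> intro h <;> linarith

end KullbackLeibler

end ContextualBayes

/-! ### The main theorem. -/

theorem mainTheorem1
    {m d : ℕ} {H : Type*} [Fintype H] [DecidableEq H]
    [MeasurableSpace H] [MeasurableSingletonClass H]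
    {Ω : Type*} [MeasurableSpace Ω] (P : Measure Ω) [IsProbabilityMeasure P]
    -- the sample space of the randomness, the true dynamics and the data
    (Ξ : Set (EuclideanSpace ℝ (Fin m))) (hΞ : IsClosed Ξ)
    (ϖ : Matrix H H ℝ) (hϖ : ϖ ∈ Matrix.rowStochastic ℝ H)
    (q : H → Ξ → ℝ) (hq : ∀ h, ContextualBayes.IsDensity (q h))
    (h₁ : H) (ξ : ℕ → Ω → Ξ) (η : ℕ → Ω → H)
    (hdata : ContextualBayes.IsDataProcess P ϖ q h₁ ξ η)
    (ν : H → ℝ) (hν : ContextualBayes.IsStationary ϖ ν)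
    -- the parametric family of densities and the prior density
    (Θ : Set (EuclideanSpace ℝ (Fin d)))
    (f : Ξ → H → EuclideanSpace ℝ (Fin d) → ℝ)
    (hf : ∀ θ ∈ Θ, ∀ h, ContextualBayes.IsDensity fun x => f x h θ)
    (p : EuclideanSpace ℝ (Fin d) → ℝ)
    (hp_meas : AEMeasurable p (volume.restrict Θ)) (hp_one : ∫ θ in Θ, p θ = 1)
    -- (i) the parameter set
    (hΘ_compact : IsCompact Θ) (hΘ_int : (interior Θ).Nonempty)
    -- (ii) bounds on the prior
    (c₁ c₂ : ℝ) (hc₂ : 0 < c₂) (hp_bound : ∀ θ ∈ Θ, c₂ ≤ p θ ∧ p θ ≤ c₁)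
    -- (iii), (iv) positivity and continuity
    (hf_pos : ∀ x h, ∀ θ ∈ Θ, 0 < f x h θ)
    (hf_cont : ∀ x h, ContinuousOn (f x h) Θ)
    -- (v) ergodicity of the context chain
    (hϖ_irred : ϖ.IsIrreducible) (hϖ_aper : ContextualBayes.IsAperiodic ϖ)
    -- (vi) integrable envelope
    (G : Ξ × H → ℝ) (hG : Integrable G (ContextualBayes.stationaryLaw ν q))
    (hfG : ∀ᵐ z ∂(ContextualBayes.stationaryLaw ν q), ∀ θ ∈ Θ,
      |Real.log (f z.1 z.2 θ)| ≤ G z)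
    -- the part of `Θ` near `Θ*` is not Lebesgue-null
    (hstar : ∀ r : ℝ, 0 < r →
      0 < volume (Θ ∩ Metric.thickening r (ContextualBayes.thetaStar ν q f Θ))) :
    -- the posterior is a probability measure
    (∀ᵐ ω ∂P, ∀ N : ℕ, 1 ≤ N →
      IsProbabilityMeasure
        (ContextualBayes.posterior ϖ f p Θ (fun t => ξ t ω) (fun t => η t ω) N)) ∧
    -- consistency
    (∀ᵐ ω ∂P, ContextualBayes.TendstoInProb
      (fun N => ContextualBayes.posterior ϖ f p Θ (fun t => ξ t ω) (fun t => η t ω) N)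
      (fun θ => Metric.infDist θ (ContextualBayes.thetaStar ν q f Θ)) 0) ∧
    -- the singleton case
    (∀ θs, ContextualBayes.thetaStar ν q f Θ = {θs} →
      ∀ᵐ ω ∂P, ContextualBayes.TendstoInProb
        (fun N => ContextualBayes.posterior ϖ f p Θ (fun t => ξ t ω) (fun t => η t ω) N)
        (fun θ => θ) θs) ∧
    -- the maximizers of `ψ` are the minimizers of the averaged KL divergence
    ((∀ h, Integrable (fun x => Real.log (q h x)) (ContextualBayes.densityMeasure (q h))) →
      ContextualBayes.thetaStar ν q f Θ =
        {θ ∈ Θ | ∀ θ' ∈ Θ, ContextualBayes.averagedKL ν q f θ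
          ≤ ContextualBayes.averagedKL ν q f θ'}) := by
  have hpos := hν.pos hϖ_irred
  have hΘ0 : volume Θ ≠ 0 :=
    (Measure.measure_pos_of_nonempty_interior volume hΘ_int).ne'
  have hmc := hdata.isMarkovChain hq
  have htrans := hmc.ae_transition_pos hϖ.1
  -- Pushed forward to the ambient space, the volume on `Ξ` is Lebesgue measure restricted to `Ξ`;
  -- closedness supplies measurability.
  have : SigmaFinite (volume : Measure Ξ) :=
    SigmaFinite.of_map _ measurable_subtype_coe.aemeasurable (by
      rw [Measure.Subtype.volume_def,
        (MeasurableEmbedding.subtype_coe hΞ.measurableSet).map_comap]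
      infer_instance)
  obtain ⟨L, hLψ, hL⟩ := ContextualBayes.exists_tendsto_average_logLikelihood hΘ_compact hϖ
    hϖ_irred hq hdata hν hf hf_pos hf_cont hG hfG
  have hcons : ∀ᵐ ω ∂P, ∀ ε : ℝ, 0 < ε → Tendsto (fun N =>
      ContextualBayes.posterior ϖ f p Θ (fun t => ξ t ω) (fun t => η t ω) N
        {θ | ε ≤ Metric.infDist θ (ContextualBayes.thetaStar ν q f Θ)}) atTop (𝓝 0) := by
    filter_upwards [hL, htrans] with ω hω hωt ε hε
    refine ContextualBayes.tendsto_posterior_compl_thickening hΘ_compact hp_meas hc₂ hp_bound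
      hf_cont hf_pos hωt hω (fun θ => ?_) (fun θ hθ => hθ.1) hstar hε
    simp only [hLψ]
    exact ⟨fun h θ' => h.2 θ' θ'.2, fun h => ⟨θ.2, fun θ' hθ' => h ⟨θ', hθ'⟩⟩⟩
  refine ⟨?_, ?_, fun θs hθs => ?_, fun hqi => ?_⟩
  · filter_upwards [htrans] with ω hω N _
    exact ContextualBayes.isProbabilityMeasure_posterior hΘ_compact hΘ0 hp_meas hc₂ hp_bound
      hf_cont hf_pos hω N
  · filter_upwards [hcons] with ω hω ε hε
    simpa [Real.dist_eq, abs_of_nonneg Metric.infDist_nonneg] using hω ε hε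
  · filter_upwards [hcons] with ω hω ε hε
    simpa [hθs] using hω ε hε
  · exact ContextualBayes.thetaStar_eq_argmin_averagedKL hpos hq hf hf_pos hG hfG hqi
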